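/- Let $\mathbf k$ be a field of characteristic zero and let $A$ be an associative (not necessarily unital) $\mathbf k$-algebra with underlying (ungraded) vector space $V$ and multiplication $\mu:V\otimes V\to V$. For $n\ge 0$ let $C^{n+1}(A,A)=\mathrm{Lin}(V^{\otimes(n+1)},V)$, placed in degree $n$, and let $C^{*+1}(A,A)=\bigoplus_{n\ge0}C^{n+1}(A,A)$. Its differential is $$\delta f(a_0,\dots,a_{n+1})=(-1)^{n+2}a_0f(a_1,\dots,a_{n+1})+f(a_0,\dots,a_n)a_{n+1}+\sum_{i=0}^{n}(-1)^{i+n+1}f(a_0,\dots,a_ia_{i+1},\dots,a_{n+1})$$ for $f\in C^{n+1}(A,A)$, and its Gerstenhaber bracket is $[f,g]=f\circ g-(-1)^{mn}g\circ f$, where for $f\in C^{m+1}(A,A)$ and $g\in C^{n+1}(A,A)$ $$f\circ g=\sum_{i=1}^{m+1}(-1)^{n(i+1)}f\circ_i g,\qquad f\circ_i g=f\big(\mathrm{id}^{\otimes(i-1)}\otimes g\otimes\mathrm{id}^{\otimes(m-i+1)}\big).$$ Let $\downarrow V$ be $V$ placed in degree $-1$, with $\downarrow:V\to\downarrow V$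 the identification map, and let ${}^cT(\downarrow V)=\bigoplus_{s\ge1}(\downarrow V)^{\otimes s}$ be the (non-counital) tensor coalgebra, with $(\downarrow V)^{\otimes s}$ in degree $-s$ and $$\Delta(w_1\otimes\dots\otimes w_n)=\sum_{i=1}^{n-1}(w_1\otimes\dots\otimes w_i)\otimes(w_{i+1}\otimes\dots\otimes w_n).$$ For $d\in\mathbb Z$, $\mathrm{CoDer}^d({}^cT(\downarrow V))$ is the space of linear maps $\theta$ of degree $d$ with $\Delta\theta(c)=\sum\theta(c_{(1)})\otimes c_{(2)}+\sum(-1)^{d|c_{(1)}|}c_{(1)}\otimes\theta(c_{(2)})$, and $\mathrm{CoDer}^*=\bigoplus_{d\in\mathbb Z}\mathrm{CoDer}^d$ carries the bracket $[\theta,\phi]=\theta\phi-(-1)^{|\theta||\phi|}\phi\theta$. The $s$-th corestriction of $\theta$ is the composition $(\downarrow V)^{\otimes s}\hookrightarrow{}^cT(\downarrow V)\xrightarrow{\theta}{}^cT(\downarrow V)\to\downarrow V$. Theorem. There is a unique $\chi\in\mathrm{CoDer}^1({}^cT(\downarrow V))$ with $\chi^2=0$ whose $s$-th corestriction vanishes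 for $s\ne2$ and whose second corestriction sends $\downarrow a\otimes\downarrow b$ to $\downarrow\mu(a,b)$. Both $(C^{*+1}(A,A),[-,-],\delta)$ and $(\mathrm{CoDer}^*({}^cT(\downarrow V)),[-,-],[\chi,-])$ are dg-Lie algebras, and there is an isomorphism of dg-Lie algebras $$\xi_A:\big(C^{*+1}(A,A),[-,-],\delta\big)\xrightarrow{\ \cong\ }\big(\mathrm{CoDer}^*({}^cT(\downarrow V)),[-,-],[\chi,-]\big).$$ It sends $\phi\in C^{n+1}(A,A)$ to a coderivation of degree $n$ whose $(n+1)$-st corestriction sends $\downarrow a_1\otimes\dots\otimes\downarrow a_{n+1}$ to $\downarrow\phi(a_1,\dots,a_{n+1})$ and whose other corestrictions vanish. It is natural in $A$: if $h:A\to B$ is an algebra homomorphism and $\phi\in C^{n+1}(A,A)$, $\psi\in C^{n+1}(B,B)$ satisfy $h\circ\phi=\psi\circ h^{\otimes(n+1)}$, then $T(\downarrow h)\circ\xi_A(\phi)=\xi_B(\psi)\circ T(\downarrow h)$; in particular $\xi$ commutes with the maps induced by algebra isomorphisms. -/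

import Mathlib

open scoped TensorProduct DirectSum

universe u v

noncomputable section

/-! ### Graded vector spaces presented as direct sums -/

/-- The `ℤ`-grading of a direct sum `⨁ n, M n` in which the summand `M n` has degree `deg n`:
an element is homogeneous of degree `i` if all its components of degree other than `i` vanish. -/
def sumGrading (k : Type u) [Field k] {ι : Type} (M : ι → Type v)
    [∀ n, AddCommGroup (M n)] [∀ n, Module k (M n)] (deg : ι → ℤ) (i : ℤ) :
    Submodule k (⨁ n, M n) where
  carrier := {x | ∀ n, x n ≠ 0 → deg n = i}
  add_mem' := by
    intro x y hx hy n hn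
    by_contra h
    have h1 : x n = 0 := by
      by_contra h1
      exact h (hx n h1)
    have h2 : y n = 0 := by
      by_contra h2
      exact h (hy n h2)
    exact hn (by rw [DirectSum.add_apply, h1, h2, add_zero])
  zero_mem' := by
    intro n hn
    exact absurd rfl hn
  smul_mem' := by
    intro c x hx n hn
    refine hx n fun h => hn ?_
    rw [DirectSum.smul_apply, h, smul_zero]

section sumGrading

variable (k : Type u) [Field k] {ι : Type} [DecidableEq ι] (M : ι → Type v)
  [∀ n, AddCommGroup (M n)] [∀ n, Module k (M n)] (deg : ι → ℤ)

theorem lof_mem_sumGrading (n : ι) (x : M n) :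
    DirectSum.lof k ι M n x ∈ sumGrading k M deg (deg n) := by
  intro m hm
  by_cases h : n = m
  · rw [h]
  · exact absurd (DFinsupp.single_eq_of_ne (Ne.symm h)) hm

/-- A direct sum is the direct sum of its homogeneous components. -/
instance sumGradingDecomposition : DirectSum.Decomposition (sumGrading k M deg) :=
  DirectSum.Decomposition.ofLinearMap (sumGrading k M deg)
    (DirectSum.toModule k ι _ fun n =>
      (DirectSum.lof k ℤ (fun i => sumGrading k M deg i) (deg n)).comp
        ((DirectSum.lof k ι M n).codRestrict (sumGrading k M deg (deg n))
          (lof_mem_sumGrading k M deg n)))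
    (by
      ext n x : 2
      simp)
    (by
      ext i x : 2
      obtain ⟨x, hx⟩ := x
      classical
      have hlof : ∀ n, ∃ z : sumGrading k M deg i, (z : ⨁ n, M n) = DirectSum.lof k ι M n (x n) ∧
          DirectSum.lof k ℤ (fun i => sumGrading k M deg i) (deg n)
              ⟨DirectSum.lof k ι M n (x n), lof_mem_sumGrading k M deg n _⟩
            = DirectSum.lof k ℤ (fun i => sumGrading k M deg i) i z := by
        intro n
        by_cases h : x n = 0
        · refine ⟨0, by simp [h], ?_⟩
          rw [map_zero]
          exact (congrArg _ (Subtype.ext (by simp [h]))).trans (map_zero _)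
        · obtain rfl := hx n h
          exact ⟨⟨_, lof_mem_sumGrading k M deg n (x n)⟩, rfl, rfl⟩
      choose z hz hz' using hlof
      have hx' : x = ∑ n ∈ DFinsupp.support x, DirectSum.lof k ι M n (x n) :=
        (DirectSum.sum_support_of x).symm
      have hsum : (⟨x, hx⟩ : sumGrading k M deg i) = ∑ n ∈ DFinsupp.support x, z n := by
        apply Subtype.ext
        rw [AddSubmonoidClass.coe_finsetSum]
        simp only [hz]
        exact hx'
      simp only [LinearMap.comp_apply, DirectSum.coeLinearMap_lof, LinearMap.id_apply]
      rw [hsum, map_sum]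
      conv_lhs => rw [hx', map_sum]
      refine Finset.sum_congr rfl fun n _ => ?_
      rw [DirectSum.toModule_lof, ← hz']
      rfl)

end sumGrading

/-- The bilinear extension to `⨁ n, M n` of bilinear maps `M m × M n → M (m + n)`. -/
def sumBilin (k : Type u) [Field k] {ι : Type} [DecidableEq ι] [Add ι] (M : ι → Type v)
    [∀ n, AddCommGroup (M n)] [∀ n, Module k (M n)]
    (B : ∀ m n, M m →ₗ[k] M n →ₗ[k] M (m + n)) :
    (⨁ n, M n) →ₗ[k] (⨁ n, M n) →ₗ[k] (⨁ n, M n) :=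
  DirectSum.toModule k ι _ fun m =>
    (DirectSum.toModule k ι _ fun n =>
      ((B m n).compr₂ (DirectSum.lof k ι M (m + n))).flip).flip

theorem sumBilin_lof (k : Type u) [Field k] {ι : Type} [DecidableEq ι] [Add ι] (M : ι → Type v)
    [∀ n, AddCommGroup (M n)] [∀ n, Module k (M n)]
    (B : ∀ m n, M m →ₗ[k] M n →ₗ[k] M (m + n)) (m n : ι) (x : M m) (y : M n) :
    sumBilin k M B (DirectSum.lof k ι M m x) (DirectSum.lof k ι M n y)
      = DirectSum.lof k ι M (m + n) (B m n x y) := by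
  simp [sumBilin]

/-! ### Differential graded Lie algebras -/

/-- The `ℤ`-graded vector space `(L, 𝓛)` is a dg-Lie algebra for the bilinear map `br` and the
linear map `d`. -/
structure IsDGLie {k : Type u} [Field k] {L : Type v} [AddCommGroup L] [Module k L]
    (𝓛 : ℤ → Submodule k L) (br : L →ₗ[k] L →ₗ[k] L) (d : L →ₗ[k] L) : Prop where
  internal : DirectSum.IsInternal 𝓛
  br_mem : ∀ i j : ℤ, ∀ a ∈ 𝓛 i, ∀ b ∈ 𝓛 j, br a b ∈ 𝓛 (i + j)
  antisymm : ∀ i j : ℤ, ∀ a ∈ 𝓛 i, ∀ b ∈ 𝓛 j, br a b = -((-1 : k) ^ (i * j) • br b a)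
  jacobi : ∀ p q r : ℤ, ∀ a ∈ 𝓛 p, ∀ b ∈ 𝓛 q, ∀ c ∈ 𝓛 r,
    br a (br b c) + (-1 : k) ^ (p * (q + r)) • br b (br c a)
      + (-1 : k) ^ (r * (p + q)) • br c (br a b) = 0
  d_mem : ∀ i : ℤ, ∀ a ∈ 𝓛 i, d a ∈ 𝓛 (i + 1)
  leibniz : ∀ i j : ℤ, ∀ a ∈ 𝓛 i, ∀ b ∈ 𝓛 j,
    d (br a b) = br (d a) b + (-1 : k) ^ i • br a (d b)
  d_sq : ∀ a, d (d a) = 0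

/-- A linear isomorphism `ξ` is an isomorphism of dg-Lie algebras: it matches the gradings, the
brackets and the differentials. -/
structure IsDGLieIso {k : Type u} [Field k] {L : Type v} [AddCommGroup L] [Module k L]
    {L' : Type*} [AddCommGroup L'] [Module k L']
    (𝓛 : ℤ → Submodule k L) (br : L →ₗ[k] L →ₗ[k] L) (d : L →ₗ[k] L)
    (𝓛' : ℤ → Submodule k L') (br' : L' →ₗ[k] L' →ₗ[k] L') (d' : L' →ₗ[k] L')
    (ξ : L ≃ₗ[k] L') : Prop where
  map_grading : ∀ i a, ξ a ∈ 𝓛' i ↔ a ∈ 𝓛 i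
  map_br : ∀ a b, ξ (br a b) = br' (ξ a) (ξ b)
  map_d : ∀ a, ξ (d a) = d' (ξ a)

/-! ### Coderivations of a graded coalgebra -/

section Coderivations

variable (k : Type u) [Field k] {C : Type v} [AddCommGroup C] [Module k C]
  (𝒞 : ℤ → Submodule k C) [DirectSum.Decomposition 𝒞] (Δ : C →ₗ[k] C ⊗[k] C)

/-- The linear map given by `c ↦ (-1) ^ (d * |c|) • c` on homogeneous elements `c`. -/
def koszulMap (d : ℤ) : C →ₗ[k] C :=
  (DirectSum.toModule k ℤ C fun i => (-1 : k) ^ (d * i) • (𝒞 i).subtype).comp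
    (DirectSum.decomposeLinearEquiv 𝒞).toLinearMap

theorem koszulMap_of_mem (d i : ℤ) (c : C) (hc : c ∈ 𝒞 i) :
    koszulMap k 𝒞 d c = (-1 : k) ^ (d * i) • c := by
  simp only [koszulMap, LinearMap.comp_apply, LinearEquiv.coe_coe,
    DirectSum.decomposeLinearEquiv_apply, DirectSum.decompose_of_mem 𝒞 hc]
  erw [DirectSum.toModule_lof]
  simp

variable {k} in
/-- The linear map `θ` has degree `d`. -/
def HasDegree (d : ℤ) (θ : Module.End k C) : Prop :=
  ∀ i : ℤ, ∀ c ∈ 𝒞 i, θ c ∈ 𝒞 (i + d)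

/-- The degree `d` coderivations of the graded coalgebra `(C, 𝒞, Δ)`: degree `d` linear maps
`θ : C → C` with `Δ θ(c) = ∑ θ(c₁) ⊗ c₂ + ∑ (-1) ^ (d * |c₁|) • c₁ ⊗ θ(c₂)`. -/
def CoDer (d : ℤ) : Submodule k (Module.End k C) where
  carrier := {θ | HasDegree 𝒞 d θ ∧
    Δ ∘ₗ θ = TensorProduct.map θ LinearMap.id ∘ₗ Δ
      + TensorProduct.map (koszulMap k 𝒞 d) θ ∘ₗ Δ}
  add_mem' := by
    rintro θ φ ⟨h1, h2⟩ ⟨h3, h4⟩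
    refine ⟨fun i c hc => (𝒞 _).add_mem (h1 i c hc) (h3 i c hc), ?_⟩
    rw [LinearMap.comp_add, h2, h4, TensorProduct.map_add_left, TensorProduct.map_add_right,
      LinearMap.add_comp, LinearMap.add_comp]
    abel
  zero_mem' := by
    refine ⟨fun i c hc => (𝒞 _).zero_mem, ?_⟩
    simp
  smul_mem' := by
    rintro a θ ⟨h1, h2⟩
    refine ⟨fun i c hc => (𝒞 _).smul_mem a (h1 i c hc), ?_⟩
    rw [LinearMap.comp_smul, h2, TensorProduct.map_smul_left, TensorProduct.map_smul_right,
      LinearMap.smul_comp, LinearMap.smul_comp, smul_add]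

theorem koszulMap_comp (a b : ℤ) (θ : Module.End k C) (hθ : HasDegree 𝒞 a θ) :
    koszulMap k 𝒞 b ∘ₗ θ = (-1 : k) ^ (a * b) • (θ ∘ₗ koszulMap k 𝒞 b) := by
  apply LinearMap.ext
  intro c
  induction c using DirectSum.Decomposition.inductionOn 𝒞 with
  | zero => simp
  | @homogeneous i c =>
    simp only [LinearMap.comp_apply, LinearMap.smul_apply]
    rw [koszulMap_of_mem k 𝒞 b i c c.2, koszulMap_of_mem k 𝒞 b _ _ (hθ i c c.2), map_smul,
      smul_smul, ← zpow_add₀ (by simp)]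
    congr 2
    ring
  | add x y hx hy => rw [map_add, map_add, hx, hy]

theorem koszulMap_add (a b : ℤ) :
    koszulMap k 𝒞 a ∘ₗ koszulMap k 𝒞 b = koszulMap k 𝒞 (a + b) := by
  apply LinearMap.ext
  intro c
  induction c using DirectSum.Decomposition.inductionOn 𝒞 with
  | zero => simp
  | @homogeneous i c =>
    rw [LinearMap.comp_apply, koszulMap_of_mem k 𝒞 b i c c.2, map_smul,
      koszulMap_of_mem k 𝒞 a i c c.2, koszulMap_of_mem k 𝒞 _ i c c.2, smul_smul,
      ← zpow_add₀ (by simp)]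
    congr 2
    ring
  | add x y hx hy => rw [map_add, map_add, hx, hy]

theorem commutator_mem_CoDer (a b : ℤ) (θ φ : Module.End k C)
    (hθ : θ ∈ CoDer k 𝒞 Δ a) (hφ : φ ∈ CoDer k 𝒞 Δ b) :
    θ ∘ₗ φ - (-1 : k) ^ (a * b) • (φ ∘ₗ θ) ∈ CoDer k 𝒞 Δ (a + b) := by
  have hs : (-1 : k) ^ (a * b) * (-1 : k) ^ (a * b) = 1 := by
    rw [← mul_zpow]
    simp
  have hcomp : ∀ (a b : ℤ) (θ φ : Module.End k C), θ ∈ CoDer k 𝒞 Δ a → φ ∈ CoDer k 𝒞 Δ b →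
      Δ ∘ₗ (θ ∘ₗ φ) = TensorProduct.map (θ ∘ₗ φ) LinearMap.id ∘ₗ Δ
        + TensorProduct.map (θ ∘ₗ koszulMap k 𝒞 b) φ ∘ₗ Δ
        + (-1 : k) ^ (a * b) • (TensorProduct.map (φ ∘ₗ koszulMap k 𝒞 a) θ ∘ₗ Δ)
        + TensorProduct.map (koszulMap k 𝒞 (a + b)) (θ ∘ₗ φ) ∘ₗ Δ := by
    rintro a b θ φ ⟨-, h2⟩ ⟨h3, h4⟩
    rw [← LinearMap.comp_assoc, h2, LinearMap.add_comp, LinearMap.comp_assoc,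
      LinearMap.comp_assoc, h4, LinearMap.comp_add, LinearMap.comp_add]
    simp only [← LinearMap.comp_assoc, ← TensorProduct.map_comp, LinearMap.id_comp,
      LinearMap.comp_id, koszulMap_add, koszulMap_comp k 𝒞 b a φ h3, TensorProduct.map_smul_left,
      LinearMap.smul_comp, mul_comm b a]
    abel
  have hl : ∀ f f' g : Module.End k C, TensorProduct.map (f - f') g
      = TensorProduct.map f g - TensorProduct.map f' g := fun f f' g =>
    TensorProduct.ext' fun x y => by simp [TensorProduct.sub_tmul]
  have hr : ∀ f g g' : Module.End k C, TensorProduct.map f (g - g')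
      = TensorProduct.map f g - TensorProduct.map f g' := fun f g g' =>
    TensorProduct.ext' fun x y => by simp [TensorProduct.tmul_sub]
  have h1 := hcomp a b θ φ hθ hφ
  have h2 := hcomp b a φ θ hφ hθ
  refine ⟨fun i c hc => (𝒞 _).sub_mem ?_ ((𝒞 _).smul_mem _ ?_), ?_⟩
  · have := hθ.1 _ _ (hφ.1 i c hc)
    rwa [show i + b + a = i + (a + b) by ring] at this
  · have := hφ.1 _ _ (hθ.1 i c hc)
    rwa [show i + a + b = i + (a + b) by ring] at this
  · rw [LinearMap.comp_sub, LinearMap.comp_smul, h1, h2, mul_comm b a, add_comm b a,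
      hl, hr, TensorProduct.map_smul_left,
      TensorProduct.map_smul_right, LinearMap.sub_comp, LinearMap.sub_comp,
      LinearMap.smul_comp, LinearMap.smul_comp]
    simp only [smul_add, smul_smul, hs, one_smul]
    abel

/-- The commutator `[θ, φ] = θ ∘ φ - (-1) ^ (a * b) • φ ∘ θ` of coderivations of degrees `a`
and `b`. -/
def coderBracket (a b : ℤ) :
    CoDer k 𝒞 Δ a →ₗ[k] CoDer k 𝒞 Δ b →ₗ[k] CoDer k 𝒞 Δ (a + b) :=
  LinearMap.mk₂ k
    (fun θ φ => ⟨(θ : Module.End k C) ∘ₗ φ - (-1 : k) ^ (a * b) • ((φ : Module.End k C) ∘ₗ θ),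
      commutator_mem_CoDer k 𝒞 Δ a b θ φ θ.2 φ.2⟩)
    (by
      intro θ θ' φ
      apply Subtype.ext
      simp only [Submodule.coe_add, LinearMap.add_comp, LinearMap.comp_add, smul_add]
      abel)
    (by
      intro c θ φ
      apply Subtype.ext
      simp only [Submodule.coe_smul, LinearMap.smul_comp, LinearMap.comp_smul, smul_sub,
        smul_comm c])
    (by
      intro θ φ φ'
      apply Subtype.ext
      simp only [Submodule.coe_add, LinearMap.add_comp, LinearMap.comp_add, smul_add]
      abel)
    (by
      intro c θ φ
      apply Subtype.ext
      simp only [Submodule.coe_smul, LinearMap.smul_comp, LinearMap.comp_smul, smul_sub,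
        smul_comm c])

/-- `CoDer^*(C) = ⨁ d, CoDer^d(C)`. -/
abbrev CoDerSum : Type v := ⨁ d : ℤ, CoDer k 𝒞 Δ d

/-- The grading of `CoDer^*(C)`. -/
abbrev coderGrading : ℤ → Submodule k (CoDerSum k 𝒞 Δ) :=
  sumGrading k (fun d => CoDer k 𝒞 Δ d) (fun d => d)

/-- The commutator bracket of `CoDer^*(C)`. -/
def coderSumBracket :
    CoDerSum k 𝒞 Δ →ₗ[k] CoDerSum k 𝒞 Δ →ₗ[k] CoDerSum k 𝒞 Δ :=
  sumBilin k (fun d => CoDer k 𝒞 Δ d) (coderBracket k 𝒞 Δ)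

/-- The map `[χ, -]` for `χ` a coderivation of degree `1`. -/
def coderDifferential (χ : CoDer k 𝒞 Δ 1) : CoDerSum k 𝒞 Δ →ₗ[k] CoDerSum k 𝒞 Δ :=
  coderSumBracket k 𝒞 Δ (DirectSum.lof k ℤ (fun d => CoDer k 𝒞 Δ d) 1 χ)

end Coderivations

/-! ### The tensor coalgebra of the desuspension -/

/-- The desuspension `↓V` of an ungraded vector space `V`: a copy of `V` placed in degree `-1`. -/
def Desusp (V : Type v) : Type v := V

instance (V : Type v) [AddCommGroup V] : AddCommGroup (Desusp V) :=
  inferInstanceAs (AddCommGroup V)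

instance (k : Type u) (V : Type v) [Field k] [AddCommGroup V] [Module k V] :
    Module k (Desusp V) :=
  inferInstanceAs (Module k V)

/-- The desuspension map `↓ : V → ↓V`. -/
def down (k : Type u) {V : Type v} [Field k] [AddCommGroup V] [Module k V] : V ≃ₗ[k] Desusp V :=
  LinearEquiv.refl k V

section TensorCoalgebra

variable (k : Type u) [Field k] (W : Type v) [AddCommGroup W] [Module k W]

/-- The underlying vector space of the (non-unital) tensor algebra, `T(W) = ⨁ W^{⊗ s}` over
`s ≥ 1`. The summand with index `n` is `W^{⊗ (n + 1)}`. -/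
abbrev TensorSum : Type (max u v) := ⨁ n : ℕ, ⨂[k]^(n + 1) W

/-- The inclusion of `W^{⊗ (n + 1)}` into `T(W)`. -/
def tensorIncl (n : ℕ) : ⨂[k]^(n + 1) W →ₗ[k] TensorSum k W :=
  DirectSum.lof k ℕ (fun n => ⨂[k]^(n + 1) W) n

/-- The projection `T(W) → W`. -/
def tensorProj : TensorSum k W →ₗ[k] W :=
  (PiTensorProduct.subsingletonEquiv (R := k) (s := fun _ : Fin 1 => W) 0).toLinearMap ∘ₗ
    DirectSum.component k ℕ (fun n => ⨂[k]^(n + 1) W) 0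

/-- Words with `n + 1` letters consist of a first part with `i + 1` and a second part with
`n - i` letters. -/
def splitEquiv (n : ℕ) (i : Fin n) : Fin (i + 1) ⊕ Fin (n - 1 - i + 1) ≃ Fin (n + 1) :=
  finSumFinEquiv.trans (finCongr (by have := i.2; omega))

/-- The deconcatenation
`w₁ ⊗ … ⊗ wₙ₊₁ ↦ (w₁ ⊗ … ⊗ wᵢ₊₁) ⊗ (wᵢ₊₂ ⊗ … ⊗ wₙ₊₁)`. -/
def deconcat (n : ℕ) (i : Fin n) :
    ⨂[k]^(n + 1) W →ₗ[k] (⨂[k]^(i + 1) W) ⊗[k] (⨂[k]^(n - 1 - i + 1) W) :=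
  (PiTensorProduct.tmulEquiv k W).symm.toLinearMap ∘ₗ
    (PiTensorProduct.reindex k (fun _ => W) (splitEquiv n i).symm).toLinearMap

/-- The comultiplication of the tensor coalgebra: the sum of all deconcatenations of a word into
two non-empty words. -/
def tensorComul : TensorSum k W →ₗ[k] TensorSum k W ⊗[k] TensorSum k W :=
  DirectSum.toModule k ℕ _ fun n => ∑ i : Fin n,
    TensorProduct.map (tensorIncl k W i) (tensorIncl k W (n - 1 - i)) ∘ₗ deconcat k W n i

theorem tensorComul_tprod (n : ℕ) (w : Fin (n + 1) → W) :
    tensorComul k W (tensorIncl k W n (PiTensorProduct.tprod k w)) = ∑ i : Fin n,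
      tensorIncl k W i (PiTensorProduct.tprod k fun j => w ⟨j, by omega⟩) ⊗ₜ[k]
        tensorIncl k W (n - 1 - i)
          (PiTensorProduct.tprod k fun j => w ⟨i + 1 + j, by omega⟩) := by
  rw [tensorComul, tensorIncl, DirectSum.toModule_lof, LinearMap.sum_apply]
  refine Finset.sum_congr rfl fun i _ => ?_
  simp only [deconcat, LinearMap.comp_apply, LinearEquiv.coe_coe]
  erw [PiTensorProduct.reindex_tprod]
  rw [PiTensorProduct.tmulEquiv_symm_apply, TensorProduct.map_tmul]
  rfl

variable {W} in
/-- The map `T(W) → T(W')` induced by a linear map `W → W'`. -/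
def tensorMap {W' : Type v} [AddCommGroup W'] [Module k W'] (h : W →ₗ[k] W') :
    TensorSum k W →ₗ[k] TensorSum k W' :=
  DirectSum.lmap fun n => PiTensorProduct.map (s := fun _ : Fin (n + 1) => W)
    (t := fun _ => W') fun _ => h

/-- The corestriction `W^{⊗ (n + 1)} → T(W) → T(W) → W` of a linear map `θ : T(W) → T(W)`. -/
def corestriction (θ : Module.End k (TensorSum k W)) (n : ℕ) : ⨂[k]^(n + 1) W →ₗ[k] W :=
  tensorProj k W ∘ₗ θ ∘ₗ tensorIncl k W n

end TensorCoalgebra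

section

variable (k : Type u) [Field k] (V : Type v) [AddCommGroup V] [Module k V]

/-- The grading of `T(↓V)` induced by that of `↓V`: since `↓V` is concentrated in degree `-1`,
the summand `(↓V)^{⊗ (n + 1)}` is concentrated in degree `-(n + 1)`. -/
abbrev tensorGrading : ℤ → Submodule k (TensorSum k (Desusp V)) :=
  sumGrading k (fun n : ℕ => ⨂[k]^(n + 1) (Desusp V)) (fun n => -((n : ℤ) + 1))

/-- `CoDer^d` of the tensor coalgebra of `↓V`. -/
abbrev TCoDer (d : ℤ) : Submodule k (Module.End k (TensorSum k (Desusp V))) :=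
  CoDer k (tensorGrading k V) (tensorComul k (Desusp V)) d

/-- `CoDer^*` of the tensor coalgebra of `↓V`. -/
abbrev TCoDerSum : Type (max u v) :=
  CoDerSum k (tensorGrading k V) (tensorComul k (Desusp V))

/-- The grading of `CoDer^*` of the tensor coalgebra of `↓V`. -/
abbrev tCoDerGrading : ℤ → Submodule k (TCoDerSum k V) :=
  coderGrading k (tensorGrading k V) (tensorComul k (Desusp V))

/-- The commutator bracket on `CoDer^*` of the tensor coalgebra of `↓V`. -/
abbrev tCoDerBracket : TCoDerSum k V →ₗ[k] TCoDerSum k V →ₗ[k] TCoDerSum k V :=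
  coderSumBracket k (tensorGrading k V) (tensorComul k (Desusp V))

variable {V} in
/-- The map `[χ, -]` on `CoDer^*` of the tensor coalgebra of `↓V`. -/
abbrev tCoDerDifferential (χ : TCoDer k V 1) : TCoDerSum k V →ₗ[k] TCoDerSum k V :=
  coderDifferential k (tensorGrading k V) (tensorComul k (Desusp V)) χ

/-- A quadratic differential on the tensor coalgebra of `↓V`: a coderivation `χ` of degree `1`
with `χ ∘ χ = 0` whose corestriction to `(↓V)^{⊗ s}` vanishes for `s ≠ 2`. -/
def IsQuadraticDifferential (χ : TCoDer k V 1) : Prop :=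
  (χ : Module.End k (TensorSum k (Desusp V))) ∘ₗ (χ : Module.End k _) = 0 ∧
    ∀ n : ℕ, n + 1 ≠ 2 → corestriction k (Desusp V) χ n = 0

end

/-! ### The Hochschild complex -/

section Hochschild

/-- The word `v₀, …, vᵢ₋₁, g(vᵢ, …, vᵢ₊ₙ), vᵢ₊ₙ₊₁, …, vₘ₊ₙ` with `m + 1` letters. -/
def insertWord {V : Type v} {m n : ℕ} (i : Fin (m + 1)) (g : (Fin (n + 1) → V) → V)
    (v : Fin (m + n + 1) → V) (j : Fin (m + 1)) : V :=
  if (j : ℕ) < i then v ⟨j, by omega⟩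
  else if (j : ℕ) = i then g fun l => v ⟨i + l, by omega⟩
  else v ⟨j + n, by omega⟩

theorem insertWord_eq_update {V : Type v} {m n : ℕ} (i : Fin (m + 1)) (g g' : (Fin (n + 1) → V) → V)
    (v : Fin (m + n + 1) → V) :
    insertWord i g v = Function.update (insertWord i g' v) i (g fun l => v ⟨i + l, by omega⟩) := by
  funext j
  by_cases h : j = i
  · subst h
    simp [insertWord]
  · have h' : (j : ℕ) ≠ i := fun e => h (Fin.ext e)
    simp [insertWord, h, h']

theorem insertWord_update {V : Type v} {m n : ℕ} (i : Fin (m + 1)) (g : (Fin (n + 1) → V) → V)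
    (v : Fin (m + n + 1) → V) (a : Fin (m + n + 1)) (x : V) :
    insertWord i g (Function.update v a x) =
      if h : (a : ℕ) < i then Function.update (insertWord i g v) ⟨a, by omega⟩ x
      else if h' : (a : ℕ) ≤ i + n then Function.update (insertWord i g v) i
        (g (Function.update (fun l => v ⟨i + l, by omega⟩) ⟨a - i, by omega⟩ x))
      else Function.update (insertWord i g v) ⟨a - n, by omega⟩ x := by
  have hsub : (fun l : Fin (n + 1) => Function.update v a x ⟨i + l, by omega⟩)
      = if h : (i : ℕ) ≤ a ∧ (a : ℕ) ≤ i + n then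
          Function.update (fun l : Fin (n + 1) => v ⟨i + l, by omega⟩) ⟨a - i, by omega⟩ x
        else fun l : Fin (n + 1) => v ⟨i + l, by omega⟩ := by
    funext l
    split_ifs with h
    · simp only [Function.update_apply, Fin.ext_iff]
      have : ((i : ℕ) + l = a) ↔ ((l : ℕ) = a - i) := by omega
      simp [this]
    · have : ¬ ((i : ℕ) + l = a) := by omega
      simp [Fin.ext_iff, this]
  funext j
  unfold insertWord
  rw [hsub]
  split_ifs <;> simp only [Function.update_apply, Fin.ext_iff] <;> split_ifs <;>
    first
      | rfl
      | omega

theorem contractNth_update {A : Type v} [Mul A] {n : ℕ} (i : Fin (n + 1)) (v : Fin (n + 2) → A)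
    (a : Fin (n + 2)) (x : A) :
    i.castSucc.contractNth (· * ·) (Function.update v a x) =
      if h : (a : ℕ) < i then
        Function.update (i.castSucc.contractNth (· * ·) v) ⟨a, by omega⟩ x
      else if (a : ℕ) = i then
        Function.update (i.castSucc.contractNth (· * ·) v) i (x * v i.succ)
      else if (a : ℕ) = i + 1 then
        Function.update (i.castSucc.contractNth (· * ·) v) i (v i.castSucc * x)
      else
        Function.update (i.castSucc.contractNth (· * ·) v) ⟨a - 1, by omega⟩ x := by
  funext j
  unfold Fin.contractNth
  simp only [Fin.val_castSucc]
  split_ifs <;> simp only [Function.update_apply, Fin.ext_iff, Fin.val_castSucc, Fin.val_succ] <;>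
    split_ifs <;>
    first
      | rfl
      | omega
      | (congr 2; apply Fin.ext; simp; omega)

section Circ

variable (k : Type u) [Field k] (V : Type v) [AddCommGroup V] [Module k V]

/-- `C^{n+1}(V, V) = Lin(V^{⊗ (n + 1)}, V)`, the `(n + 1)`-multilinear maps. -/
abbrev Cochain (n : ℕ) : Type v := MultilinearMap k (fun _ : Fin (n + 1) => V) V

variable {V} in
/-- `(f ∘ᵢ g)(v₀, …, vₘ₊ₙ) = f(v₀, …, vᵢ₋₁, g(vᵢ, …, vᵢ₊ₙ), vᵢ₊ₙ₊₁, …, vₘ₊ₙ)`. The argument `i`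
counts from `0`. -/
def circAt {m n : ℕ} (i : Fin (m + 1)) (f : Cochain k V m) (g : Cochain k V n) :
    Cochain k V (m + n) :=
  MultilinearMap.mk' (fun v => f (insertWord i g v))
    (by
      intro v a x y
      simp only [insertWord_update]
      split_ifs <;> simp only [MultilinearMap.map_update_add])
    (by
      intro v a c x
      simp only [insertWord_update]
      split_ifs <;> simp only [MultilinearMap.map_update_smul])

/-- `f ∘ g = ∑_{i=1}^{m+1} (-1) ^ (n * (i + 1)) f ∘ᵢ g`, as a bilinear map. -/
def circ (m n : ℕ) : Cochain k V m →ₗ[k] Cochain k V n →ₗ[k] Cochain k V (m + n) :=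
  ∑ i : Fin (m + 1), (-1 : k) ^ (n * ((i + 1) + 1)) •
    LinearMap.mk₂ k (fun f g => circAt k i f g)
      (fun f f' g => by ext v; rfl)
      (fun c f g => by ext v; rfl)
      (fun f g g' => by
        ext v
        change f _ = f _ + f _
        rw [insertWord_eq_update i _ 0, insertWord_eq_update i g 0, insertWord_eq_update i g' 0,
          add_apply, MultilinearMap.map_update_add])
      (fun c f g => by
        ext v
        change f _ = c • f _
        rw [insertWord_eq_update i _ 0, insertWord_eq_update i g 0,
          smul_apply, MultilinearMap.map_update_smul])

variable {V} in
/-- A cochain in `C^{n+m+1}` regarded as an element of `C^{m+n+1}`. -/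
def castCochain (m n : ℕ) : Cochain k V (n + m) ≃ₗ[k] Cochain k V (m + n) :=
  MultilinearMap.domDomCongrLinearEquiv k k V V (finCongr (by omega))

/-- The Gerstenhaber bracket `[f, g] = f ∘ g - (-1) ^ (m * n) g ∘ f`. -/
def gerstenhaber (m n : ℕ) : Cochain k V m →ₗ[k] Cochain k V n →ₗ[k] Cochain k V (m + n) :=
  circ k V m n
    - (-1 : k) ^ (m * n) • ((circ k V n m).compr₂ (castCochain k m n).toLinearMap).flip

/-- The space `C^{*+1}(V, V) = ⨁ C^{n+1}(V, V)` over `n ≥ 0`. -/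
abbrev CochainSum : Type v := ⨁ n : ℕ, Cochain k V n

/-- The grading of `C^{*+1}(V, V)`: the summand `C^{n+1}` has degree `n`. -/
abbrev cochainGrading : ℤ → Submodule k (CochainSum k V) :=
  sumGrading k (fun n => Cochain k V n) (fun n : ℕ => (n : ℤ))

/-- The Gerstenhaber bracket on `C^{*+1}(V, V)`. -/
def gerstenhaberSum : CochainSum k V →ₗ[k] CochainSum k V →ₗ[k] CochainSum k V :=
  sumBilin k (fun n => Cochain k V n) (gerstenhaber k V)

end Circ

section Differential

variable (k : Type u) [Field k] (A : Type v) [NonUnitalRing A] [Module k A]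
  [IsScalarTower k A A] [SMulCommClass k A A]

variable {A}

/-- `(a₀, …, aₙ₊₁) ↦ a₀ f(a₁, …, aₙ₊₁)`. -/
def leftMulCochain {n : ℕ} (f : Cochain k A n) : Cochain k A (n + 1) :=
  MultilinearMap.mk' (fun a => a 0 * f (Fin.tail a))
    (by
      intro v i x y
      cases i using Fin.cases with
      | zero => simp [Fin.tail_update_zero, add_mul]
      | succ i => simp [Fin.tail_update_succ, mul_add, (Fin.succ_ne_zero i).symm])
    (by
      intro v i c x
      cases i using Fin.cases with
      | zero => simp [Fin.tail_update_zero, smul_mul_assoc]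
      | succ i => simp [Fin.tail_update_succ, mul_smul_comm, (Fin.succ_ne_zero i).symm])

/-- `(a₀, …, aₙ₊₁) ↦ f(a₀, …, aₙ) aₙ₊₁`. -/
def rightMulCochain {n : ℕ} (f : Cochain k A n) : Cochain k A (n + 1) :=
  MultilinearMap.mk' (fun a => f (Fin.init a) * a (Fin.last (n + 1)))
    (by
      intro v i x y
      cases i using Fin.lastCases with
      | last => simp [Fin.init_update_last, mul_add]
      | cast i => simp [Fin.init_update_castSucc, add_mul, (Fin.castSucc_lt_last i).ne'])
    (by
      intro v i c x
      cases i using Fin.lastCases with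
      | last => simp [Fin.init_update_last, mul_smul_comm]
      | cast i => simp [Fin.init_update_castSucc, smul_mul_assoc, (Fin.castSucc_lt_last i).ne'])

/-- `(a₀, …, aₙ₊₁) ↦ f(a₀, …, aᵢ aᵢ₊₁, …, aₙ₊₁)`. -/
def contractCochain {n : ℕ} (i : Fin (n + 1)) (f : Cochain k A n) : Cochain k A (n + 1) :=
  MultilinearMap.mk' (fun a => f (i.castSucc.contractNth (· * ·) a))
    (by
      intro v a x y
      simp only [contractNth_update]
      split_ifs <;> simp only [add_mul, mul_add, MultilinearMap.map_update_add])
    (by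
      intro v a c x
      simp only [contractNth_update]
      split_ifs <;>
        simp only [smul_mul_assoc, mul_smul_comm, MultilinearMap.map_update_smul])

variable (A)

/-- The Hochschild differential `C^{n+1}(A, A) → C^{n+2}(A, A)`; see `hochschild_apply`. -/
def hochschild (n : ℕ) : Cochain k A n →ₗ[k] Cochain k A (n + 1) where
  toFun f := (-1 : k) ^ (n + 2) • leftMulCochain k f + rightMulCochain k f
    + ∑ i : Fin (n + 1), (-1 : k) ^ ((i : ℕ) + (n + 1)) • contractCochain k i f
  map_add' f g := by
    have h1 : leftMulCochain k (f + g) = leftMulCochain k f + leftMulCochain k g := by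
      ext a
      exact mul_add _ _ _
    have h2 : rightMulCochain k (f + g) = rightMulCochain k f + rightMulCochain k g := by
      ext a
      exact add_mul _ _ _
    have h3 : ∀ i, contractCochain k i (f + g)
        = contractCochain k i f + contractCochain k i g := fun i => rfl
    simp only [h1, h2, h3, smul_add, Finset.sum_add_distrib]
    abel
  map_smul' c f := by
    have h1 : leftMulCochain k (c • f) = c • leftMulCochain k f := by
      ext a
      exact mul_smul_comm _ _ _
    have h2 : rightMulCochain k (c • f) = c • rightMulCochain k f := by
      ext a
      exact smul_mul_assoc _ _ _
    have h3 : ∀ i, contractCochain k i (c • f) = c • contractCochain k i f := fun i => rfl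
    simp only [h1, h2, h3, smul_add, Finset.smul_sum, smul_comm _ c, RingHom.id_apply]

theorem hochschild_apply (n : ℕ) (f : Cochain k A n) (a : Fin (n + 2) → A) :
    hochschild k A n f a =
      (-1 : k) ^ (n + 2) • (a 0 * f fun j => a j.succ)
        + (f fun j => a j.castSucc) * a (Fin.last (n + 1))
        + ∑ i : Fin (n + 1), (-1 : k) ^ ((i : ℕ) + (n + 1)) •
            f (i.castSucc.contractNth (· * ·) a) := by
  change ((-1 : k) ^ (n + 2) • leftMulCochain k f + rightMulCochain k f
    + ∑ i : Fin (n + 1), (-1 : k) ^ ((i : ℕ) + (n + 1)) • contractCochain k i f) a = _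
  rw [add_apply, add_apply, sum_apply]
  rfl

/-- The Hochschild differential of `C^{*+1}(A, A)`. -/
def hochschildSum : CochainSum k A →ₗ[k] CochainSum k A :=
  DirectSum.toModule k ℕ _ fun n =>
    DirectSum.lof k ℕ (fun n => Cochain k A n) (n + 1) ∘ₗ hochschild k A n

end Differential
end Hochschild

/-! ### The correspondence between multiplications, cochains and coderivations -/

section Correspondence

variable (k : Type u) [Field k] (A : Type v) [NonUnitalRing A] [Module k A]

/-- The coderivation `χ` corresponds to the multiplication `μ` of `A`: the corestriction
`f : ↓A ⊗ ↓A → ↓A` of `χ` satisfies `f ∘ (↓ ⊗ ↓) = ↓ ∘ μ`. Elements of `A` have degree `0`, so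
`(↓ ⊗ ↓)(a ⊗ b) = ↓a ⊗ ↓b`. -/
def CorrespondsToMul (χ : TCoDer k A 1) : Prop :=
  ∀ a b : A, corestriction k (Desusp A) χ 1 (PiTensorProduct.tprod k ![down k a, down k b])
    = down k (a * b)

variable {A} in
/-- The coderivation `θ` has `(n + 1)`st corestriction `f` with `f ∘ ↓^{⊗ (n + 1)} = ↓ ∘ φ`, and
its other corestrictions vanish. -/
def IsCoderivationOf {n : ℕ} (φ : Cochain k A n) (θ : TCoDer k A n) : Prop :=
  (∀ a : Fin (n + 1) → A,
    corestriction k (Desusp A) θ n (PiTensorProduct.tprod k fun i => down k (a i))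
      = down k (φ a)) ∧
  ∀ s : ℕ, s ≠ n → corestriction k (Desusp A) θ s = 0

variable {A} in
/-- The map `T(↓A) → T(↓B)` induced by an algebra homomorphism `h : A → B`. -/
def tensorMapDesusp {B : Type v} [NonUnitalRing B] [Module k B] (h : A →ₙₐ[k] B) :
    TensorSum k (Desusp A) →ₗ[k] TensorSum k (Desusp B) :=
  tensorMap k ((down k).toLinearMap ∘ₗ (h : A →ₗ[k] B) ∘ₗ (down k).symm.toLinearMap)

end Correspondence

end

/-!
A coderivation `θ` of `T(↓V)` is determined by its corestrictions: the kernel of `Δ` is `↓V`, and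
the value of `Δθ` on a word involves only the values of `θ` on shorter words. For degree
reasons a coderivation of degree `n` has a single nonzero corestriction, on words with `n + 1`
letters, and none at all if `n < 0`. Conversely every cochain `φ` of degree `n` is the corestriction
of the coderivation that applies `φ` to all subwords with `n + 1` letters. This gives the bijection
`ξ`.

Two coderivations of the same degree are compared through their corestrictions. The corestriction of
`ξ(f)ξ(g)` is `f ∘ g`, so `ξ` turns the Gerstenhaber bracket into the commutator. The Hochschild
differential is `[μ, -]`, so `ξ` also turns it into `[χ, -]` with `χ = ξ(μ)`. Since `χ` is odd, `χ²`
is again a coderivation, and it vanishes because its corestriction is `μ ∘ μ`, the associator of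
`A`. The dg-Lie axioms hold for graded commutators and are transported along `ξ`.
-/

noncomputable section

theorem neg_one_zpow_mul_self {k : Type*} [DivisionRing k] (a : ℤ) :
    (-1 : k) ^ a * (-1 : k) ^ a = 1 := by
  rcases Int.even_or_odd a with h | h <;> simp [h.neg_one_zpow]

theorem neg_one_zpow_add {k : Type*} [DivisionRing k] (a b : ℤ) :
    (-1 : k) ^ (a + b) = (-1 : k) ^ a * (-1 : k) ^ b :=
  zpow_add₀ (neg_ne_zero.2 one_ne_zero) a b

theorem neg_one_zpow_neg {k : Type*} [DivisionRing k] (a : ℤ) : (-1 : k) ^ (-a) = (-1 : k) ^ a := by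
  rw [zpow_neg, ← inv_zpow, inv_neg_one]

/-! ### Direct sums -/

section DirectSumReindex

variable {k : Type*} [Semiring k] {ι κ : Type*} [DecidableEq ι] [DecidableEq κ]
  {M : ι → Type*} [∀ i, AddCommMonoid (M i)] [∀ i, Module k (M i)]
  {N : κ → Type*} [∀ j, AddCommMonoid (N j)] [∀ j, Module k (N j)]
  {f : ι → κ} (E : ∀ i, M i →ₗ[k] N (f i))

/-- The map of direct sums that sends the `i`th summand to the `f i`th one by `E i`, for a map `f`
of index sets. -/
def directSumReindex : (⨁ i, M i) →ₗ[k] ⨁ j, N j :=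
  DirectSum.toModule k ι _ fun i => DirectSum.lof k κ N (f i) ∘ₗ E i

theorem directSumReindex_lof (i : ι) (x : M i) :
    directSumReindex E (DirectSum.lof k ι M i x) = DirectSum.lof k κ N (f i) (E i x) := by
  rw [directSumReindex, DirectSum.toModule_lof, LinearMap.comp_apply]

theorem directSumReindex_apply (hf : Function.Injective f) (x : ⨁ i, M i) (i : ι) :
    directSumReindex E x (f i) = E i (x i) := by
  suffices DirectSum.component k κ N (f i) ∘ₗ directSumReindex E
      = E i ∘ₗ DirectSum.component k ι M i from LinearMap.congr_fun this x
  refine DirectSum.linearMap_ext k fun j => LinearMap.ext fun y => ?_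
  simp only [LinearMap.comp_apply, directSumReindex_lof]
  obtain rfl | hij := eq_or_ne j i
  · rw [DirectSum.component.lof_self, DirectSum.component.lof_self]
  · rw [DirectSum.component.of, dif_neg (hf.ne hij), DirectSum.component.of, dif_neg hij, map_zero]

theorem directSumReindex_injective (hf : Function.Injective f)
    (hE : ∀ i, Function.Injective (E i)) : Function.Injective (directSumReindex E) := by
  refine fun x y hxy => DFinsupp.ext fun i => hE i ?_
  rw [← directSumReindex_apply E hf, ← directSumReindex_apply E hf, hxy]

theorem directSumReindex_surjective (hE : ∀ i, Function.Surjective (E i))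
    (hN : ∀ j ∉ Set.range f, Subsingleton (N j)) : Function.Surjective (directSumReindex E) := by
  intro y
  induction y using DirectSum.induction_on with
  | zero => exact ⟨0, map_zero _⟩
  | add y z hy hz =>
    obtain ⟨x, rfl⟩ := hy
    obtain ⟨w, rfl⟩ := hz
    exact ⟨x + w, map_add _ x w⟩
  | of j y =>
    by_cases hj : j ∈ Set.range f
    · obtain ⟨i, rfl⟩ := hj
      obtain ⟨x, rfl⟩ := hE i y
      exact ⟨_, directSumReindex_lof E i x⟩
    · have := hN j hj
      exact ⟨0, by rw [Subsingleton.elim y 0, map_zero, map_zero]⟩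

end DirectSumReindex

section SumGrading

variable {k : Type u} [Field k] {ι κ : Type} [DecidableEq ι] [DecidableEq κ]
  {M : ι → Type*} [∀ i, AddCommGroup (M i)] [∀ i, Module k (M i)]
  {N : κ → Type*} [∀ j, AddCommGroup (N j)] [∀ j, Module k (N j)]

theorem eq_lof_of_mem_sumGrading {deg : ι → ℤ} (hdeg : Function.Injective deg) {i : ι}
    {x : ⨁ i, M i} (hx : x ∈ sumGrading k M deg (deg i)) : x = DirectSum.lof k ι M i (x i) := by
  refine DFinsupp.ext fun j => ?_
  change x j = DirectSum.component k ι M j (DirectSum.lof k ι M i (x i))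
  rw [DirectSum.component.of]
  split_ifs with h
  · subst h
    rfl
  · by_contra hj
    exact h (hdeg (hx j hj)).symm

theorem directSumReindex_mem_sumGrading_iff {f : ι → κ} {E : ∀ i, M i →ₗ[k] N (f i)}
    (hf : Function.Injective f) (hE : ∀ i, Function.Injective (E i))
    (hN : ∀ j ∉ Set.range f, Subsingleton (N j)) (deg : κ → ℤ) (d : ℤ) (x : ⨁ i, M i) :
    directSumReindex E x ∈ sumGrading k N deg d ↔ x ∈ sumGrading k M (deg ∘ f) d := by
  constructor
  · refine fun h i hi => h (f i) ?_
    rwa [directSumReindex_apply E hf, Ne, map_eq_zero_iff _ (hE i)]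
  · intro h j hj
    obtain ⟨i, rfl⟩ : j ∈ Set.range f := by
      by_contra hr
      have := hN j hr
      exact hj (Subsingleton.elim _ _)
    refine h i fun hi => hj ?_
    rw [directSumReindex_apply E hf, hi, map_zero]

end SumGrading

section LofSubmodule

variable {k : Type*} [Semiring k] {E : Type*} [AddCommMonoid E] [Module k E] {ι : Type*}
  [DecidableEq ι] {S : ι → Submodule k E}

theorem lof_eq_lof_of_coe_eq {i j : ι} (hij : i = j) {x : S i} {y : S j} (hxy : (x : E) = y) :
    DirectSum.lof k ι (fun i => S i) i x = DirectSum.lof k ι (fun i => S i) j y := by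
  subst hij
  rw [Subtype.ext hxy]

theorem lof_eq_lof_add_smul_lof {i j l : ι} (hij : i = j) (hil : i = l) {x : S i} {y : S j}
    {z : S l} {c : k} (h : (x : E) = y + c • (z : E)) :
    DirectSum.lof k ι (fun i => S i) i x
      = DirectSum.lof k ι (fun i => S i) j y + c • DirectSum.lof k ι (fun i => S i) l z := by
  subst hij hil
  rw [← map_smul, ← map_add]
  exact congrArg _ (Subtype.ext h)

end LofSubmodule

/-! ### Graded commutators and graded Lie algebras -/

section GradedCommutator

variable (k : Type*) [Field k] {R : Type*} [Ring R] [Algebra k R]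

/-- The commutator of an element `x` of degree `p` and an element `y` of degree `q` in a graded
associative algebra. The degrees are arguments, so that no grading of the algebra is needed. -/
def gradedCommutator (p q : ℤ) (x y : R) : R :=
  x * y - (-1 : k) ^ (p * q) • (y * x)

theorem gradedCommutator_swap (p q : ℤ) (x y : R) :
    gradedCommutator k p q x y = -((-1 : k) ^ (p * q) • gradedCommutator k q p y x) := by
  rw [gradedCommutator, gradedCommutator, smul_sub, smul_smul, mul_comm q p,
    neg_one_zpow_mul_self, one_smul, neg_sub]

theorem gradedCommutator_leibniz (p q r : ℤ) (x y z : R) :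
    gradedCommutator k p (q + r) x (gradedCommutator k q r y z)
      = gradedCommutator k (p + q) r (gradedCommutator k p q x y) z
        + (-1 : k) ^ (p * q) • gradedCommutator k q (p + r) y (gradedCommutator k p r x z) := by
  have hpq : (-1 : k) ^ (p * q) * (-1 : k) ^ (p * q) = 1 := neg_one_zpow_mul_self _
  simp only [gradedCommutator, mul_add, add_mul, mul_comm q p, neg_one_zpow_add, mul_sub, sub_mul,
    mul_smul_comm, smul_mul_assoc, smul_sub, smul_smul, mul_assoc]
  linear_combination (norm := module) ((-1 : k) ^ (q * r) * hpq) • (x * (z * y))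
    - ((-1 : k) ^ (p * r) * (-1 : k) ^ (q * r) * hpq) • (z * (x * y))

theorem gradedCommutator_self_gradedCommutator {p : ℤ} (hp : Odd p) (q : ℤ) {x : R}
    (hx : x * x = 0) (y : R) :
    gradedCommutator k p (p + q) x (gradedCommutator k p q x y) = 0 := by
  have hsign : (-1 : k) ^ (p * (p + q)) = -(-1 : k) ^ (p * q) := by
    rw [mul_add, neg_one_zpow_add, (hp.mul hp).neg_one_zpow, neg_one_mul]
  simp only [gradedCommutator, hsign, mul_sub, sub_mul, mul_smul_comm, smul_mul_assoc]
  rw [← mul_assoc x x, hx, mul_assoc y, hx, ← mul_assoc x y]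
  simp

end GradedCommutator

section GradedLie

variable {k : Type u} [Field k] {L : Type v} [AddCommGroup L] [Module k L]
  {𝓛 : ℤ → Submodule k L} {br : L →ₗ[k] L →ₗ[k] L}

/- Antisymmetry turns the Leibniz rule for `[a, -]` into the Jacobi identity, so the Leibniz rule
gives both `jacobi` and `leibniz`. -/
theorem isDGLie_inner (internal : DirectSum.IsInternal 𝓛)
    (br_mem : ∀ i j : ℤ, ∀ a ∈ 𝓛 i, ∀ b ∈ 𝓛 j, br a b ∈ 𝓛 (i + j))
    (antisymm : ∀ i j : ℤ, ∀ a ∈ 𝓛 i, ∀ b ∈ 𝓛 j, br a b = -((-1 : k) ^ (i * j) • br b a))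
    (leibniz : ∀ p q r : ℤ, ∀ a ∈ 𝓛 p, ∀ b ∈ 𝓛 q, ∀ c ∈ 𝓛 r,
      br a (br b c) = br (br a b) c + (-1 : k) ^ (p * q) • br b (br a c))
    {χ : L} (hχ : χ ∈ 𝓛 1) (hsq : ∀ a, br χ (br χ a) = 0) : IsDGLie 𝓛 br (br χ) where
  internal := internal
  br_mem := br_mem
  antisymm := antisymm
  jacobi p q r a ha b hb c hc := by
    have hsign : (-1 : k) ^ (p * (q + r)) * (-1 : k) ^ (r * p) = (-1 : k) ^ (p * q) := by
      rw [mul_add, neg_one_zpow_add, mul_assoc, mul_comm r p,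
        neg_one_zpow_mul_self, mul_one]
    rw [leibniz p q r a ha b hb c hc,
      antisymm (p + q) r (br a b) (br_mem p q a ha b hb) c hc, antisymm r p c hc a ha,
      map_neg, map_smul, smul_neg, smul_smul, hsign, mul_comm r]
    abel
  d_mem i a ha := add_comm 1 i ▸ br_mem 1 i χ hχ a ha
  leibniz i j a ha b hb := by
    rw [leibniz 1 i j χ hχ a ha b hb, one_mul]
  d_sq := hsq

theorem IsDGLieIso.isDGLie {L' : Type*} [AddCommGroup L'] [Module k L'] {d : L →ₗ[k] L}
    {𝓛' : ℤ → Submodule k L'} {br' : L' →ₗ[k] L' →ₗ[k] L'} {d' : L' →ₗ[k] L'}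
    {ξ : L ≃ₗ[k] L'} (hξ : IsDGLieIso 𝓛 br d 𝓛' br' d' ξ) (h : IsDGLie 𝓛' br' d')
    (internal : DirectSum.IsInternal 𝓛) : IsDGLie 𝓛 br d where
  internal := internal
  br_mem i j a ha b hb := by
    rw [← hξ.map_grading] at *
    rw [hξ.map_br]
    exact h.br_mem i j _ ha _ hb
  antisymm i j a ha b hb := by
    apply ξ.injective
    rw [← hξ.map_grading] at *
    simpa only [map_neg, map_smul, hξ.map_br] using h.antisymm i j _ ha _ hb
  jacobi p q r a ha b hb c hc := by
    apply ξ.injective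
    rw [← hξ.map_grading] at *
    simpa only [map_add, map_zero, map_smul, hξ.map_br] using h.jacobi p q r _ ha _ hb _ hc
  d_mem i a ha := by
    rw [← hξ.map_grading] at *
    rw [hξ.map_d]
    exact h.d_mem i _ ha
  leibniz i j a ha b hb := by
    apply ξ.injective
    rw [← hξ.map_grading] at *
    simpa only [map_add, map_smul, hξ.map_br, hξ.map_d] using h.leibniz i j _ ha _ hb
  d_sq a := by
    apply ξ.injective
    simpa only [map_zero, hξ.map_d] using h.d_sq (ξ a)

end GradedLie

/-! ### The dg-Lie algebra of coderivations -/

section CoderLie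

variable {k : Type u} [Field k] {C : Type v} [AddCommGroup C] [Module k C]
  {𝒞 : ℤ → Submodule k C} [DirectSum.Decomposition 𝒞] {Δ : C →ₗ[k] C ⊗[k] C}

theorem eq_lof_of_mem_coderGrading {i : ℤ} {a : CoDerSum k 𝒞 Δ} (ha : a ∈ coderGrading k 𝒞 Δ i) :
    a = DirectSum.lof k ℤ (fun d => CoDer k 𝒞 Δ d) i (a i) :=
  eq_lof_of_mem_sumGrading (deg := fun d => d) Function.injective_id ha

theorem coe_coderBracket {a b : ℤ} (x : CoDer k 𝒞 Δ a) (y : CoDer k 𝒞 Δ b) :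
    (coderBracket k 𝒞 Δ a b x y : Module.End k C) = gradedCommutator k a b x.1 y.1 := rfl

theorem coderSumBracket_lof {a b : ℤ} (x : CoDer k 𝒞 Δ a) (y : CoDer k 𝒞 Δ b) :
    coderSumBracket k 𝒞 Δ (DirectSum.lof k ℤ (fun d => CoDer k 𝒞 Δ d) a x)
        (DirectSum.lof k ℤ (fun d => CoDer k 𝒞 Δ d) b y)
      = DirectSum.lof k ℤ (fun d => CoDer k 𝒞 Δ d) (a + b) (coderBracket k 𝒞 Δ a b x y) :=
  sumBilin_lof k (fun d => CoDer k 𝒞 Δ d) (coderBracket k 𝒞 Δ) a b x y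

theorem coderSumBracket_mem {i j : ℤ} {a b : CoDerSum k 𝒞 Δ} (ha : a ∈ coderGrading k 𝒞 Δ i)
    (hb : b ∈ coderGrading k 𝒞 Δ j) : coderSumBracket k 𝒞 Δ a b ∈ coderGrading k 𝒞 Δ (i + j) := by
  rw [eq_lof_of_mem_coderGrading ha, eq_lof_of_mem_coderGrading hb, coderSumBracket_lof]
  exact lof_mem_sumGrading k (fun d => CoDer k 𝒞 Δ d) (fun d => d) (i + j) _

theorem coderSumBracket_antisymm {i j : ℤ} {a b : CoDerSum k 𝒞 Δ} (ha : a ∈ coderGrading k 𝒞 Δ i)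
    (hb : b ∈ coderGrading k 𝒞 Δ j) :
    coderSumBracket k 𝒞 Δ a b = -((-1 : k) ^ (i * j) • coderSumBracket k 𝒞 Δ b a) := by
  rw [eq_lof_of_mem_coderGrading ha, eq_lof_of_mem_coderGrading hb, coderSumBracket_lof,
    coderSumBracket_lof, ← map_smul, ← map_neg]
  exact lof_eq_lof_of_coe_eq (add_comm i j) (gradedCommutator_swap k i j _ _)

theorem coderSumBracket_leibniz {p q r : ℤ} {a b c : CoDerSum k 𝒞 Δ}
    (ha : a ∈ coderGrading k 𝒞 Δ p) (hb : b ∈ coderGrading k 𝒞 Δ q)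
    (hc : c ∈ coderGrading k 𝒞 Δ r) :
    coderSumBracket k 𝒞 Δ a (coderSumBracket k 𝒞 Δ b c)
      = coderSumBracket k 𝒞 Δ (coderSumBracket k 𝒞 Δ a b) c
        + (-1 : k) ^ (p * q) • coderSumBracket k 𝒞 Δ b (coderSumBracket k 𝒞 Δ a c) := by
  rw [eq_lof_of_mem_coderGrading ha, eq_lof_of_mem_coderGrading hb, eq_lof_of_mem_coderGrading hc]
  simp only [coderSumBracket_lof]
  exact lof_eq_lof_add_smul_lof (by ring) (by ring) (gradedCommutator_leibniz k p q r _ _ _)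

theorem coderDifferential_sq {χ : CoDer k 𝒞 Δ 1} (hχ : χ.1 ∘ₗ χ.1 = 0) (a : CoDerSum k 𝒞 Δ) :
    coderDifferential k 𝒞 Δ χ (coderDifferential k 𝒞 Δ χ a) = 0 := by
  suffices coderDifferential k 𝒞 Δ χ ∘ₗ coderDifferential k 𝒞 Δ χ = 0 from
    LinearMap.congr_fun this a
  refine DirectSum.linearMap_ext k fun i => LinearMap.ext fun x => ?_
  simp only [LinearMap.comp_apply, LinearMap.zero_apply, coderDifferential, coderSumBracket_lof]
  refine (congrArg _ (Subtype.ext ?_)).trans (map_zero _)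
  exact gradedCommutator_self_gradedCommutator k odd_one i hχ x.1

theorem isDGLie_coder {χ : CoDer k 𝒞 Δ 1} (hχ : χ.1 ∘ₗ χ.1 = 0) :
    IsDGLie (L := CoDerSum k 𝒞 Δ) (coderGrading k 𝒞 Δ) (coderSumBracket k 𝒞 Δ)
      (coderDifferential k 𝒞 Δ χ) := by
  refine isDGLie_inner (L := CoDerSum k 𝒞 Δ) (𝓛 := coderGrading k 𝒞 Δ)
    (br := coderSumBracket k 𝒞 Δ) (χ := DirectSum.lof k ℤ (fun d => CoDer k 𝒞 Δ d) 1 χ)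
    ?_ ?_ ?_ ?_ ?_ ?_
  · exact DirectSum.Decomposition.isInternal _
  · exact fun _ _ _ ha _ hb => coderSumBracket_mem ha hb
  · exact fun _ _ _ ha _ hb => coderSumBracket_antisymm ha hb
  · exact fun _ _ _ _ ha _ hb _ hc => coderSumBracket_leibniz ha hb hc
  · exact lof_mem_sumGrading k (fun d => CoDer k 𝒞 Δ d) (fun d => d) 1 χ
  · exact coderDifferential_sq hχ

/- In `Δ(θθ)` the two mixed terms `θκ ⊗ θ` and `κθ ⊗ θ`, with `κ` the Koszul sign, cancel. The
identity `[θ, θ] = 2θθ` would give the claim only in characteristic different from two. -/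
theorem comp_self_mem_CoDer {a : ℤ} (ha : Odd a) {θ : Module.End k C} (hθ : θ ∈ CoDer k 𝒞 Δ a) :
    θ ∘ₗ θ ∈ CoDer k 𝒞 Δ (a + a) := by
  refine ⟨fun i c hc => add_assoc i a a ▸ hθ.1 _ _ (hθ.1 i c hc), ?_⟩
  have hmixed : TensorProduct.map (koszulMap k 𝒞 a ∘ₗ θ) θ
      = -TensorProduct.map (θ ∘ₗ koszulMap k 𝒞 a) θ := by
    rw [koszulMap_comp k 𝒞 a a θ hθ.1, (ha.mul ha).neg_one_zpow, TensorProduct.map_smul_left]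
    exact LinearMap.ext fun x => neg_one_smul k _
  calc Δ ∘ₗ θ ∘ₗ θ
      = (TensorProduct.map θ LinearMap.id + TensorProduct.map (koszulMap k 𝒞 a) θ) ∘ₗ
          (TensorProduct.map θ LinearMap.id + TensorProduct.map (koszulMap k 𝒞 a) θ) ∘ₗ Δ := by
        rw [← LinearMap.comp_assoc, hθ.2, ← LinearMap.add_comp, LinearMap.comp_assoc, hθ.2,
          ← LinearMap.add_comp]
    _ = TensorProduct.map (θ ∘ₗ θ) LinearMap.id ∘ₗ Δ
          + TensorProduct.map (koszulMap k 𝒞 (a + a)) (θ ∘ₗ θ) ∘ₗ Δ := by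
        rw [← LinearMap.comp_assoc, LinearMap.add_comp, LinearMap.comp_add, LinearMap.comp_add]
        simp only [← TensorProduct.map_comp, LinearMap.id_comp, LinearMap.comp_id, hmixed,
          koszulMap_add, LinearMap.add_comp, LinearMap.neg_comp]
        abel

end CoderLie

/-! ### Words in the tensor coalgebra -/

section Words

variable (k : Type u) [Field k] {W : Type v} [AddCommGroup W] [Module k W]

/-- The word `w₀ ⊗ … ⊗ w_N` in `T(W)`. Words are parametrized by infinite sequences, of which only
the first `N + 1` terms matter, so that their subwords are again words of shifted sequences. -/
def word (w : ℕ → W) (N : ℕ) : TensorSum k W :=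
  tensorIncl k W N (PiTensorProduct.tprod k fun j : Fin (N + 1) => w j)

variable {k}

theorem linearMap_ext_word {E : Type*} [AddCommMonoid E] [Module k E]
    {f g : TensorSum k W →ₗ[k] E} (h : ∀ w N, f (word k w N) = g (word k w N)) : f = g := by
  refine DirectSum.linearMap_ext k fun N => PiTensorProduct.ext (MultilinearMap.ext fun w => ?_)
  obtain ⟨v, rfl⟩ := Fin.val_injective.surjective_comp_right w
  exact h v N

theorem corestriction_ext {θ φ : Module.End k (TensorSum k W)} {n : ℕ}
    (h : ∀ w, tensorProj k W (θ (word k w n)) = tensorProj k W (φ (word k w n))) :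
    corestriction k W θ n = corestriction k W φ n := by
  refine PiTensorProduct.ext (MultilinearMap.ext fun w => ?_)
  obtain ⟨v, rfl⟩ := Fin.val_injective.surjective_comp_right w
  exact h v

theorem tensorProj_word (w : ℕ → W) (N : ℕ) :
    tensorProj k W (word k w N) = if N = 0 then w 0 else 0 := by
  simp only [tensorProj, word, tensorIncl, LinearMap.comp_apply, LinearEquiv.coe_coe]
  split_ifs with h
  · subst h
    rw [DirectSum.component.lof_self]
    exact PiTensorProduct.subsingletonEquiv_apply_tprod _ _
  · rw [DirectSum.component.of, dif_neg h, map_zero]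

theorem tensorComul_word (w : ℕ → W) (N : ℕ) :
    tensorComul k W (word k w N) = ∑ i ∈ Finset.range N,
      word k w i ⊗ₜ[k] word k (fun j => w (i + 1 + j)) (N - 1 - i) := by
  rw [word, tensorComul_tprod, ← Fin.sum_univ_eq_sum_range (fun i =>
    word k w i ⊗ₜ[k] word k (fun j => w (i + 1 + j)) (N - 1 - i))]
  rfl

variable (k W) in
/-- The embedding of `T(W)` into the unital tensor algebra. -/
def toTensorAlgebra : TensorSum k W →ₗ[k] TensorAlgebra k W :=
  TensorAlgebra.ofDirectSum.toLinearMap ∘ₗ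
    directSumReindex (N := fun n => ⨂[k]^n W) (f := Nat.succ) fun _ => LinearMap.id

theorem toTensorAlgebra_injective : Function.Injective (toTensorAlgebra k W) :=
  (TensorAlgebra.equivDirectSum (R := k) (M := W)).symm.injective.comp
    (directSumReindex_injective _ Nat.succ_injective fun _ => Function.injective_id)

theorem toTensorAlgebra_word (w : ℕ → W) (N : ℕ) :
    toTensorAlgebra k W (word k w N)
      = (List.ofFn fun j : Fin (N + 1) => TensorAlgebra.ι k (w j)).prod := by
  rw [toTensorAlgebra, LinearMap.comp_apply, word, tensorIncl, directSumReindex_lof]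
  exact TensorAlgebra.ofDirectSum_of_tprod _

theorem mul_ι_tensorProj_tensorComul (x : TensorSum k W) :
    LinearMap.mul' k (TensorAlgebra k W) (TensorProduct.map
        (TensorAlgebra.ι k ∘ₗ tensorProj k W) (toTensorAlgebra k W) (tensorComul k W x))
      + TensorAlgebra.ι k (tensorProj k W x) = toTensorAlgebra k W x := by
  suffices LinearMap.mul' k (TensorAlgebra k W) ∘ₗ TensorProduct.map
        (TensorAlgebra.ι k ∘ₗ tensorProj k W) (toTensorAlgebra k W) ∘ₗ tensorComul k W
      + TensorAlgebra.ι k ∘ₗ tensorProj k W = toTensorAlgebra k W from LinearMap.congr_fun this x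
  refine linearMap_ext_word fun w N => ?_
  simp only [LinearMap.add_apply, LinearMap.comp_apply, tensorComul_word, map_sum,
    TensorProduct.map_tmul, LinearMap.mul'_apply, tensorProj_word, toTensorAlgebra_word]
  cases N with
  | zero => simp
  | succ N =>
    rw [Finset.sum_range_succ', Finset.sum_eq_zero fun i _ => by simp, List.ofFn_succ,
      List.prod_cons]
    simp [add_comm 1]

/- An element of `T(W)` can be recovered from its first letters and the rest of its words. -/
theorem eq_zero_of_tensorComul_eq_zero {x : TensorSum k W} (hΔ : tensorComul k W x = 0)
    (hx : tensorProj k W x = 0) : x = 0 :=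
  toTensorAlgebra_injective (by
    rw [← mul_ι_tensorProj_tensorComul, hΔ, hx]
    simp only [map_zero, add_zero])

theorem coder_ext {𝒞 : ℤ → Submodule k (TensorSum k W)} [DirectSum.Decomposition 𝒞] {d : ℤ}
    {θ φ : Module.End k (TensorSum k W)} (hθ : θ ∈ CoDer k 𝒞 (tensorComul k W) d)
    (hφ : φ ∈ CoDer k 𝒞 (tensorComul k W) d)
    (h : ∀ n, corestriction k W θ n = corestriction k W φ n) : θ = φ := by
  refine linearMap_ext_word fun w N => ?_
  induction N using Nat.strong_induction_on generalizing w with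
  | _ N ih =>
    refine sub_eq_zero.1 (eq_zero_of_tensorComul_eq_zero ?_ ?_)
    · have hθ' := LinearMap.congr_fun hθ.2 (word k w N)
      have hφ' := LinearMap.congr_fun hφ.2 (word k w N)
      simp only [LinearMap.comp_apply, LinearMap.add_apply, tensorComul_word, map_sum,
        TensorProduct.map_tmul] at hθ' hφ'
      rw [map_sub, sub_eq_zero, hθ', hφ']
      congr 1 <;> refine Finset.sum_congr rfl fun i hi => ?_ <;> rw [Finset.mem_range] at hi
      · rw [ih i hi]
      · rw [ih (N - 1 - i) (by omega)]
    · rw [map_sub, sub_eq_zero]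
      exact LinearMap.congr_fun (h N) (PiTensorProduct.tprod k fun j => w j)

end Words

section DownWord

variable (k : Type u) [Field k] {V : Type v} [AddCommGroup V] [Module k V]

/-- The word `↓v₀ ⊗ … ⊗ ↓v_N` in `T(↓V)`, for a sequence in `V`. -/
abbrev downWord (v : ℕ → V) (N : ℕ) : TensorSum k (Desusp V) :=
  word k (fun j => down k (v j)) N

theorem downWord_congr {v w : ℕ → V} {N : ℕ} (h : ∀ j ≤ N, v j = w j) :
    downWord k v N = downWord k w N := by
  unfold downWord word
  congr 2
  funext j
  exact congrArg (down k) (h j (by omega))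

theorem linearMap_ext_downWord {E : Type*} [AddCommMonoid E] [Module k E]
    {f g : TensorSum k (Desusp V) →ₗ[k] E}
    (h : ∀ v N, f (downWord k v N) = g (downWord k v N)) : f = g :=
  linearMap_ext_word fun w N => h (fun j => (down k).symm (w j)) N

theorem downWord_mem (v : ℕ → V) (N : ℕ) :
    downWord k v N ∈ tensorGrading k V (-((N : ℤ) + 1)) :=
  lof_mem_sumGrading k (fun n : ℕ => ⨂[k]^(n + 1) (Desusp V)) (fun n => -((n : ℤ) + 1)) N _

theorem koszulMap_downWord (n N : ℕ) (v : ℕ → V) :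
    koszulMap k (tensorGrading k V) n (downWord k v N)
      = (-1 : k) ^ (n * (N + 1)) • downWord k v N := by
  rw [koszulMap_of_mem k _ _ _ _ (downWord_mem k v N), mul_neg, neg_one_zpow_neg]
  congr 1
  exact_mod_cast rfl

variable {k}

theorem hasDegree_of_downWord {d : ℤ} {θ : Module.End k (TensorSum k (Desusp V))}
    (h : ∀ (v : ℕ → V) (N : ℕ), θ (downWord k v N) ∈ tensorGrading k V (-((N : ℤ) + 1) + d)) :
    HasDegree (tensorGrading k V) d θ := by
  have hN (N : ℕ) (x : ⨂[k]^(N + 1) (Desusp V)) :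
      θ (tensorIncl k _ N x) ∈ tensorGrading k V (-((N : ℤ) + 1) + d) := by
    induction x using PiTensorProduct.induction_on with
    | smul_tprod r w =>
      obtain ⟨v, rfl⟩ := Fin.val_injective.surjective_comp_right w
      rw [map_smul, map_smul]
      exact Submodule.smul_mem _ r (h (fun j => (down k).symm (v j)) N)
    | add x y hx hy =>
      rw [map_add, map_add]
      exact Submodule.add_mem _ hx hy
  intro i c hc
  classical
  rw [← DirectSum.sum_support_of c, map_sum]
  refine Submodule.sum_mem _ fun N hmem => ?_
  rw [← hc N (DFinsupp.mem_support_iff.1 hmem)]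
  exact hN N _

theorem corestriction_eq_zero_of_hasDegree {d : ℤ} {θ : Module.End k (TensorSum k (Desusp V))}
    (hθ : HasDegree (tensorGrading k V) d θ) {n : ℕ} (h : d ≠ n) :
    corestriction k (Desusp V) θ n = 0 := by
  refine LinearMap.ext fun x => ?_
  have hcomp : θ (tensorIncl k _ n x) 0 = 0 := by
    by_contra h0
    have hdeg := hθ _ _ (lof_mem_sumGrading k (fun n : ℕ => ⨂[k]^(n + 1) (Desusp V))
      (fun n => -((n : ℤ) + 1)) n x) 0 h0
    push_cast at hdeg
    omega
  change PiTensorProduct.subsingletonEquiv (s := fun _ : Fin 1 => Desusp V) 0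
    (θ (tensorIncl k _ n x) 0) = 0
  rw [hcomp, map_zero]

end DownWord

/-! ### The coderivation of a cochain -/

section InsertSeq

variable {V : Type*} {n : ℕ}

/-- The sequence `v₀, …, vᵢ₋₁, g(vᵢ, …, vᵢ₊ₙ), vᵢ₊ₙ₊₁, …`; compare `insertWord`. -/
def insertSeq (i : ℕ) (g : (Fin (n + 1) → V) → V) (v : ℕ → V) (j : ℕ) : V :=
  if j < i then v j else if j = i then g fun l => v (i + l) else v (j + n)

variable (g : (Fin (n + 1) → V) → V) (v : ℕ → V)

theorem insertSeq_of_lt {i j : ℕ} (h : j < i) : insertSeq i g v j = v j := if_pos h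

theorem insertSeq_of_gt {i j : ℕ} (h : i < j) : insertSeq i g v j = v (j + n) := by
  rw [insertSeq, if_neg h.not_gt, if_neg h.ne']

theorem insertSeq_self (i : ℕ) : insertSeq i g v i = g fun l => v (i + l) := by
  rw [insertSeq, if_neg (lt_irrefl i), if_pos rfl]

theorem insertSeq_add_left (i a j : ℕ) :
    insertSeq (a + i) g v (a + j) = insertSeq i g (fun l => v (a + l)) j := by
  simp only [insertSeq, add_lt_add_iff_left, add_right_inj, add_assoc]

theorem map_insertSeq {W : Type*} (h : V → W) {g' : (Fin (n + 1) → W) → W}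
    (hg : ∀ a, h (g a) = g' fun l => h (a l)) (i j : ℕ) :
    h (insertSeq i g v j) = insertSeq i g' (fun l => h (v l)) j := by
  simp only [insertSeq, apply_ite h, hg]

end InsertSeq

section CochainCoder

variable (k : Type u) [Field k] {V : Type v} [AddCommGroup V] [Module k V]

/-- The multilinear map `v ↦ F(v₀, …, vᵢ₋₁, φ(vᵢ, …, vᵢ₊ₙ), vᵢ₊ₙ₊₁, …, vₘ₊ₙ)`; the case of a
cochain `F` is `circAt`. -/
def insertMultilinear {E : Type*} [AddCommMonoid E] [Module k E] {m n : ℕ} (i : Fin (m + 1))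
    (F : MultilinearMap k (fun _ : Fin (m + 1) => V) E) (φ : Cochain k V n) :
    MultilinearMap k (fun _ : Fin (m + n + 1) => V) E :=
  MultilinearMap.mk' (fun v => F (insertWord i φ v))
    (by
      intro v a x y
      simp only [insertWord_update]
      split_ifs <;> simp only [MultilinearMap.map_update_add])
    (by
      intro v a c x
      simp only [insertWord_update]
      split_ifs <;> simp only [MultilinearMap.map_update_smul])

/-- The restriction of `cochainCoder k φ` to words with `N + 1` letters. -/
def cochainCoderOn {n : ℕ} (φ : Cochain k V n) (N : ℕ) :
    ⨂[k]^(N + 1) (Desusp V) →ₗ[k] TensorSum k (Desusp V) :=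
  if h : n ≤ N then
    PiTensorProduct.lift ((MultilinearMap.domDomCongr (finCongr (by omega))
      (∑ i : Fin (N - n + 1), (-1 : k) ^ (n * (i : ℕ)) • insertMultilinear k i
        ((tensorIncl k (Desusp V) (N - n)).compMultilinearMap
          ((PiTensorProduct.tprod k).compLinearMap fun _ => (down k).toLinearMap))
        φ)).compLinearMap fun _ => (down k).symm.toLinearMap)
  else 0

/-- The coderivation of `T(↓V)` with corestriction `φ`: it applies `φ` to all subwords with `n + 1`
letters, with the sign `(-1) ^ (n * i)` from moving `φ` past the first `i` letters. -/
def cochainCoder {n : ℕ} (φ : Cochain k V n) : Module.End k (TensorSum k (Desusp V)) :=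
  DirectSum.toModule k ℕ _ (cochainCoderOn k φ)

variable {n : ℕ} (φ : Cochain k V n) (v : ℕ → V)

theorem cochainCoder_downWord_of_lt {N : ℕ} (h : N < n) :
    cochainCoder k φ (downWord k v N) = 0 := by
  rw [cochainCoder, downWord, word, tensorIncl, DirectSum.toModule_lof, cochainCoderOn,
    dif_neg h.not_ge, LinearMap.zero_apply]

theorem cochainCoder_downWord_add (M : ℕ) :
    cochainCoder k φ (downWord k v (M + n)) = ∑ i ∈ Finset.range (M + 1),
      (-1 : k) ^ (n * i) • downWord k (insertSeq i φ v) M := by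
  obtain ⟨N, hN⟩ : ∃ N, N = M + n := ⟨_, rfl⟩
  obtain rfl : M = N - n := by omega
  rw [← hN, cochainCoder, downWord, word, tensorIncl, DirectSum.toModule_lof, cochainCoderOn,
    dif_pos (by omega), PiTensorProduct.lift.tprod,
    ← Fin.sum_univ_eq_sum_range (fun i => (-1 : k) ^ (n * i) •
        downWord k (insertSeq i φ v) (N - n))]
  simp only [MultilinearMap.compLinearMap_apply, MultilinearMap.domDomCongr_apply, sum_apply,
    smul_apply]
  rfl

theorem tensorProj_cochainCoder (N : ℕ) :
    tensorProj k (Desusp V) (cochainCoder k φ (downWord k v N))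
      = if N = n then down k (φ fun l => v l) else 0 := by
  obtain hN | hN := lt_or_ge N n
  · rw [cochainCoder_downWord_of_lt k φ v hN, map_zero, if_neg hN.ne]
  · obtain ⟨M, rfl⟩ := Nat.exists_eq_add_of_le' hN
    simp only [cochainCoder_downWord_add, map_sum, map_smul, tensorProj_word, Nat.add_eq_right]
    split_ifs with hM
    · subst hM
      simp [insertSeq_self]
    · simp only [smul_zero, Finset.sum_const_zero]

theorem corestriction_cochainCoder (a : Fin (n + 1) → V) :
    corestriction k (Desusp V) (cochainCoder k φ) n
      (PiTensorProduct.tprod k fun i => down k (a i)) = down k (φ a) := by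
  obtain ⟨v, rfl⟩ := Fin.val_injective.surjective_comp_right a
  exact (tensorProj_cochainCoder k φ v n).trans (if_pos rfl)

theorem hasDegree_cochainCoder : HasDegree (tensorGrading k V) n (cochainCoder k φ) := by
  refine hasDegree_of_downWord fun v N => ?_
  obtain hN | hN := lt_or_ge N n
  · rw [cochainCoder_downWord_of_lt k φ v hN]
    exact Submodule.zero_mem _
  · obtain ⟨M, rfl⟩ := Nat.exists_eq_add_of_le' hN
    rw [cochainCoder_downWord_add, show -(((M + n : ℕ) : ℤ) + 1) + n = -((M : ℤ) + 1) by
      push_cast; ring]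
    exact Submodule.sum_mem _ fun i _ => Submodule.smul_mem _ _ (downWord_mem k _ M)

theorem tensorComul_cochainCoder_downWord (M : ℕ) :
    tensorComul k (Desusp V) (cochainCoder k φ (downWord k v (M + n)))
      = ∑ j ∈ Finset.range M, ∑ i ∈ Finset.range (M + 1), (-1 : k) ^ (n * i) •
          downWord k (insertSeq i φ v) j ⊗ₜ[k]
            downWord k (fun l => insertSeq i φ v (j + 1 + l)) (M - 1 - j) := by
  simp only [cochainCoder_downWord_add, map_sum, map_smul, tensorComul_word, Finset.smul_sum]
  exact Finset.sum_comm

theorem map_cochainCoder_id_tensorComul_downWord (M : ℕ) :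
    TensorProduct.map (cochainCoder k φ) LinearMap.id
        (tensorComul k (Desusp V) (downWord k v (M + n)))
      = ∑ j ∈ Finset.range M, ∑ i ∈ Finset.range (j + 1), (-1 : k) ^ (n * i) •
          downWord k (insertSeq i φ v) j ⊗ₜ[k]
            downWord k (fun l => v (j + 1 + l + n)) (M - 1 - j) := by
  simp only [tensorComul_word, map_sum, TensorProduct.map_tmul, LinearMap.id_apply]
  rw [add_comm M n, Finset.sum_range_add, Finset.sum_eq_zero fun a ha => by
    rw [cochainCoder_downWord_of_lt k φ v (Finset.mem_range.1 ha), TensorProduct.zero_tmul],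
    zero_add]
  refine Finset.sum_congr rfl fun j _ => ?_
  rw [add_comm n j, cochainCoder_downWord_add, TensorProduct.sum_tmul,
    show n + M - 1 - (j + n) = M - 1 - j by omega]
  refine Finset.sum_congr rfl fun i _ => ?_
  rw [TensorProduct.smul_tmul']
  congr 1
  exact downWord_congr k fun l _ => congrArg v (by ring)

theorem map_koszulMap_cochainCoder_tensorComul_downWord (M : ℕ) :
    TensorProduct.map (koszulMap k (tensorGrading k V) n) (cochainCoder k φ)
        (tensorComul k (Desusp V) (downWord k v (M + n)))
      = ∑ j ∈ Finset.range M, ∑ i ∈ Finset.range (M - j), (-1 : k) ^ (n * (j + 1 + i)) •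
          downWord k v j ⊗ₜ[k]
            downWord k (insertSeq i φ fun l => v (j + 1 + l)) (M - 1 - j) := by
  simp only [tensorComul_word, map_sum, TensorProduct.map_tmul, koszulMap_downWord]
  rw [Finset.sum_range_add, Finset.sum_eq_zero (s := Finset.range n) fun a ha => by
    rw [Finset.mem_range] at ha
    rw [cochainCoder_downWord_of_lt k φ _ (by omega), TensorProduct.tmul_zero], add_zero]
  refine Finset.sum_congr rfl fun j hj => ?_
  rw [Finset.mem_range] at hj
  rw [show M + n - 1 - j = M - 1 - j + n by omega, cochainCoder_downWord_add,
    show M - 1 - j + 1 = M - j by omega, TensorProduct.tmul_sum]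
  simp only [TensorProduct.tmul_smul, ← TensorProduct.smul_tmul', smul_smul, ← pow_add,
    mul_add, add_comm, add_left_comm]

/- Cut after `j + 1` letters of the result: `φ` was applied before the cut if `i ≤ j` and after it
otherwise. -/
theorem cochainCoder_mem : cochainCoder k φ ∈ TCoDer k V n := by
  refine ⟨hasDegree_cochainCoder k φ, linearMap_ext_downWord k fun v N => ?_⟩
  change tensorComul k _ (cochainCoder k φ (downWord k v N))
    = TensorProduct.map _ _ (tensorComul k _ (downWord k v N))
      + TensorProduct.map _ _ (tensorComul k _ (downWord k v N))
  obtain hN | hN := lt_or_ge N n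
  · simp only [cochainCoder_downWord_of_lt k φ v hN, tensorComul_word, map_sum,
      TensorProduct.map_tmul, map_zero]
    rw [Finset.sum_eq_zero, Finset.sum_eq_zero, add_zero] <;> intro i hi <;>
      rw [Finset.mem_range] at hi
    · rw [cochainCoder_downWord_of_lt k φ _ (by omega), TensorProduct.tmul_zero]
    · rw [cochainCoder_downWord_of_lt k φ _ (by omega), TensorProduct.zero_tmul]
  · obtain ⟨M, rfl⟩ := Nat.exists_eq_add_of_le' hN
    rw [tensorComul_cochainCoder_downWord, map_cochainCoder_id_tensorComul_downWord,
      map_koszulMap_cochainCoder_tensorComul_downWord, ← Finset.sum_add_distrib]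
    refine Finset.sum_congr rfl fun j hj => ?_
    rw [Finset.mem_range] at hj
    rw [show M + 1 = j + 1 + (M - j) by omega, Finset.sum_range_add]
    congr 1 <;> refine Finset.sum_congr rfl fun i hi => ?_ <;> rw [Finset.mem_range] at hi
    · congr 2
      exact downWord_congr k fun l _ => insertSeq_of_gt _ _ (by omega)
    · congr 2
      · exact downWord_congr k fun l _ => insertSeq_of_lt _ _ (by omega)
      · exact downWord_congr k fun l _ => insertSeq_add_left _ _ _ _ _

end CochainCoder

/-! ### The isomorphism of cochains and coderivations -/

section Isomorphism

variable (k : Type u) [Field k] {V : Type v} [AddCommGroup V] [Module k V]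

theorem corestriction_cochainCoder_of_ne {n s : ℕ} (φ : Cochain k V n) (hs : s ≠ n) :
    corestriction k (Desusp V) (cochainCoder k φ) s = 0 :=
  corestriction_eq_zero_of_hasDegree (hasDegree_cochainCoder k φ) (Nat.cast_injective.ne hs.symm)

theorem eq_cochainCoder {n : ℕ} {φ : Cochain k V n} {θ : Module.End k (TensorSum k (Desusp V))}
    (hθ : θ ∈ TCoDer k V n)
    (h : ∀ v, tensorProj k (Desusp V) (θ (downWord k v n)) = down k (φ fun l => v l)) :
    θ = cochainCoder k φ := by
  refine coder_ext hθ (cochainCoder_mem k φ) fun s => ?_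
  obtain rfl | hs := eq_or_ne s n
  · refine corestriction_ext fun w => ?_
    have hw := h fun j => (down k).symm (w j)
    exact hw.trans ((tensorProj_cochainCoder k φ _ s).trans (if_pos rfl)).symm
  · rw [corestriction_cochainCoder_of_ne k φ hs,
      corestriction_eq_zero_of_hasDegree hθ.1 (Nat.cast_injective.ne hs.symm)]

/-- The linear map that sends a cochain `φ` to the coderivation `cochainCoder k φ`. -/
def cochainToCoder (n : ℕ) : Cochain k V n →ₗ[k] TCoDer k V n where
  toFun φ := ⟨cochainCoder k φ, cochainCoder_mem k φ⟩
  map_add' φ ψ := Subtype.ext (eq_cochainCoder k ((TCoDer k V n).add_mem (cochainCoder_mem k φ)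
    (cochainCoder_mem k ψ)) fun v => by
      simp only [LinearMap.add_apply, map_add, tensorProj_cochainCoder, if_true, add_apply]).symm
  map_smul' c φ := Subtype.ext (eq_cochainCoder k ((TCoDer k V n).smul_mem c
    (cochainCoder_mem k φ)) fun v => by
      simp only [LinearMap.smul_apply, map_smul, tensorProj_cochainCoder, if_true, smul_apply]).symm

theorem coe_cochainToCoder {n : ℕ} (φ : Cochain k V n) :
    (cochainToCoder k n φ : Module.End k (TensorSum k (Desusp V))) = cochainCoder k φ := rfl

theorem isCoderivationOf_cochainToCoder {A : Type v} [NonUnitalRing A] [Module k A] {n : ℕ}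
    (φ : Cochain k A n) : IsCoderivationOf k φ (cochainToCoder k n φ) :=
  ⟨corestriction_cochainCoder k φ, fun _ => corestriction_cochainCoder_of_ne k φ⟩

theorem cochainToCoder_injective (n : ℕ) :
    Function.Injective (cochainToCoder k (V := V) n) := by
  refine fun φ ψ h => MultilinearMap.ext fun a => (down k).injective ?_
  rw [← corestriction_cochainCoder, ← corestriction_cochainCoder, ← coe_cochainToCoder, h,
    coe_cochainToCoder]

theorem cochainToCoder_surjective (n : ℕ) :
    Function.Surjective (cochainToCoder k (V := V) n) := fun θ =>
  ⟨(((down k).symm.toLinearMap ∘ₗ corestriction k (Desusp V) θ n).compMultilinearMap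
      (PiTensorProduct.tprod k)).compLinearMap fun _ => (down k).toLinearMap,
    Subtype.ext (eq_cochainCoder k θ.2 fun _ => rfl).symm⟩

theorem subsingleton_coder_of_neg {d : ℤ} (hd : d < 0) : Subsingleton (TCoDer k V d) := by
  refine ⟨fun θ φ => Subtype.ext (coder_ext θ.2 φ.2 fun n => ?_)⟩
  rw [corestriction_eq_zero_of_hasDegree θ.2.1 (by omega),
    corestriction_eq_zero_of_hasDegree φ.2.1 (by omega)]

theorem subsingleton_coder_of_notMem_range {d : ℤ} (hd : d ∉ Set.range ((↑) : ℕ → ℤ)) :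
    Subsingleton (TCoDer k V d) :=
  subsingleton_coder_of_neg k (by
    by_contra! h
    exact hd ⟨d.toNat, Int.toNat_of_nonneg h⟩)

variable (V) in
/-- The isomorphism `ξ` from `C^{*+1}(V, V)` to `CoDer^*(T(↓V))`. -/
def cochainCoderEquiv : CochainSum k V ≃ₗ[k] TCoDerSum k V :=
  LinearEquiv.ofBijective (directSumReindex (N := fun d => TCoDer k V d) (cochainToCoder k))
    ⟨directSumReindex_injective _ Nat.cast_injective (cochainToCoder_injective k),
      directSumReindex_surjective _ (cochainToCoder_surjective k)
        fun _ => subsingleton_coder_of_notMem_range k⟩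

theorem cochainCoderEquiv_lof (n : ℕ) (φ : Cochain k V n) :
    cochainCoderEquiv k V (DirectSum.lof k ℕ (fun n => Cochain k V n) n φ)
      = DirectSum.lof k ℤ (fun d => TCoDer k V d) n (cochainToCoder k n φ) :=
  directSumReindex_lof _ n φ

theorem coe_cochainCoderEquiv_lof (n : ℕ) (φ : Cochain k V n) :
    (cochainCoderEquiv k V (DirectSum.lof k ℕ (fun n => Cochain k V n) n φ) n :
      Module.End k (TensorSum k (Desusp V))) = cochainCoder k φ := by
  rw [cochainCoderEquiv_lof, ← coe_cochainToCoder]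
  exact congrArg Subtype.val (DirectSum.component.lof_self (R := k)
    (M := fun d : ℤ => TCoDer k V d) (i := (n : ℤ)) (cochainToCoder k n φ))

theorem cochainCoderEquiv_mem_iff (i : ℤ) (a : CochainSum k V) :
    cochainCoderEquiv k V a ∈ tCoDerGrading k V i ↔ a ∈ cochainGrading k V i := by
  apply directSumReindex_mem_sumGrading_iff (deg := fun d => d) Nat.cast_injective
    (cochainToCoder_injective k)
  exact fun _ => subsingleton_coder_of_notMem_range k

end Isomorphism

/-! ### Compatibility with the brackets -/

section Bracket

variable (k : Type u) [Field k] {V : Type v} [AddCommGroup V] [Module k V]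

theorem circ_apply {m n : ℕ} (f : Cochain k V m) (g : Cochain k V n) (v : ℕ → V) :
    circ k V m n f g (fun l => v l)
      = ∑ i ∈ Finset.range (m + 1), (-1 : k) ^ (n * i) • f fun l => insertSeq i g v l := by
  rw [← Fin.sum_univ_eq_sum_range (fun i => (-1 : k) ^ (n * i) • f fun l => insertSeq i g v l),
    circ, LinearMap.sum_apply, LinearMap.sum_apply, sum_apply]
  refine Finset.sum_congr rfl fun i _ => ?_
  have hsign : (-1 : k) ^ (n * ((i : ℕ) + 1 + 1)) = (-1 : k) ^ (n * (i : ℕ)) := by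
    rw [add_assoc, one_add_one_eq_two, mul_add, pow_add, (even_two.mul_left n).neg_one_pow, mul_one]
  rw [hsign]
  rfl

theorem gerstenhaber_apply {m n : ℕ} (f : Cochain k V m) (g : Cochain k V n) (v : ℕ → V) :
    gerstenhaber k V m n f g (fun l => v l)
      = circ k V m n f g (fun l => v l)
        - (-1 : k) ^ (m * n) • circ k V n m g f (fun l => v l) := rfl

theorem tensorProj_cochainCoder_comp {m n N : ℕ} (hN : N = m + n) (f : Cochain k V m)
    (g : Cochain k V n) (v : ℕ → V) :
    tensorProj k (Desusp V) (cochainCoder k f (cochainCoder k g (downWord k v N)))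
      = down k (circ k V m n f g fun l => v l) := by
  subst hN
  simp only [cochainCoder_downWord_add, circ_apply, map_sum, map_smul, tensorProj_cochainCoder,
    if_true]

theorem cochainCoder_gerstenhaber {m n : ℕ} (f : Cochain k V m) (g : Cochain k V n) :
    (coderBracket k (tensorGrading k V) (tensorComul k (Desusp V)) m n (cochainToCoder k m f)
      (cochainToCoder k n g) : Module.End k _) = cochainCoder k (gerstenhaber k V m n f g) := by
  refine eq_cochainCoder k ?_ fun v => ?_
  · rw [Nat.cast_add]
    exact Subtype.property _
  · rw [coe_coderBracket, gradedCommutator, ← Nat.cast_mul, zpow_natCast, LinearMap.sub_apply,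
      LinearMap.smul_apply, map_sub, map_smul, Module.End.mul_apply, Module.End.mul_apply,
      coe_cochainToCoder, coe_cochainToCoder, tensorProj_cochainCoder_comp k rfl,
      tensorProj_cochainCoder_comp k (add_comm m n), gerstenhaber_apply, map_sub, map_smul]

theorem cochainCoderEquiv_bracket (a b : CochainSum k V) :
    cochainCoderEquiv k V (gerstenhaberSum k V a b)
      = tCoDerBracket k V (cochainCoderEquiv k V a) (cochainCoderEquiv k V b) := by
  suffices (gerstenhaberSum k V).compr₂ (cochainCoderEquiv k V).toLinearMap
      = (tCoDerBracket k V).compl₁₂ (cochainCoderEquiv k V).toLinearMap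
        (cochainCoderEquiv k V).toLinearMap from LinearMap.congr_fun₂ this a b
  refine DirectSum.linearMap_ext k fun m => LinearMap.ext fun f =>
    DirectSum.linearMap_ext k fun n => LinearMap.ext fun g => ?_
  simp only [LinearMap.comp_apply, LinearMap.compr₂_apply, LinearMap.compl₁₂_apply,
    LinearEquiv.coe_coe, cochainCoderEquiv_lof, coderSumBracket_lof, gerstenhaberSum, sumBilin_lof]
  exact lof_eq_lof_of_coe_eq (Nat.cast_add m n) (cochainCoder_gerstenhaber k f g).symm

end Bracket

/-! ### Compatibility with the differentials -/

section Differential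

variable (k : Type u) [Field k]

theorem cochain_lof_congr {V : Type v} [AddCommGroup V] [Module k V] {m n : ℕ} (h : m = n)
    {f : Cochain k V m} {g : Cochain k V n} (hfg : ∀ v : ℕ → V, f (fun l => v l) = g fun l => v l) :
    DirectSum.lof k ℕ (fun n => Cochain k V n) m f
      = DirectSum.lof k ℕ (fun n => Cochain k V n) n g := by
  subst h
  congr 1
  refine MultilinearMap.ext fun a => ?_
  obtain ⟨v, rfl⟩ := Fin.val_injective.surjective_comp_right a
  exact hfg v

variable (A : Type v) [NonUnitalRing A] [Module k A] [IsScalarTower k A A] [SMulCommClass k A A]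

/-- The multiplication of `A` as a cochain. -/
def mulCochain : Cochain k A 1 :=
  leftMulCochain k (MultilinearMap.ofSubsingleton k A A (0 : Fin 1) LinearMap.id)

variable {A}

theorem mulCochain_apply (a : Fin 2 → A) : mulCochain k A a = a 0 * a 1 := rfl

theorem circ_mulCochain_left {n : ℕ} (f : Cochain k A n) (v : ℕ → A) :
    circ k A 1 n (mulCochain k A) f (fun l => v l)
      = f (fun l => v l) * v (n + 1) + (-1 : k) ^ n • (v 0 * f fun l => v (l + 1)) := by
  simp [circ_apply, Finset.sum_range_succ, mulCochain_apply, insertSeq, add_comm]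

theorem circ_mulCochain_right {n : ℕ} (f : Cochain k A n) (v : ℕ → A) :
    circ k A n 1 f (mulCochain k A) (fun l => v l)
      = ∑ i : Fin (n + 1), (-1 : k) ^ (i : ℕ) •
          f (i.castSucc.contractNth (· * ·) fun l => v l) := by
  rw [circ_apply, ← Fin.sum_univ_eq_sum_range (fun i => (-1 : k) ^ (1 * i) •
    f fun l => insertSeq i (mulCochain k A) v l)]
  refine Finset.sum_congr rfl fun i _ => ?_
  rw [one_mul]
  congr 2
  funext j
  simp only [Fin.contractNth, insertSeq, mulCochain_apply, Fin.val_castSucc, Fin.val_succ]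
  split_ifs with hlt heq
  · rfl
  · simp [heq]
  · rfl

theorem circ_mulCochain_self : circ k A 1 1 (mulCochain k A) (mulCochain k A) = 0 := by
  refine MultilinearMap.ext fun a => ?_
  obtain ⟨v, rfl⟩ := Fin.val_injective.surjective_comp_right a
  refine (circ_mulCochain_left k _ v).trans ?_
  simp [mulCochain_apply, mul_assoc]

theorem hochschild_eq_gerstenhaber {n : ℕ} (f : Cochain k A n) (v : ℕ → A) :
    hochschild k A n f (fun l => v l)
      = gerstenhaber k A 1 n (mulCochain k A) f fun l => v l := by
  rw [hochschild_apply, gerstenhaber_apply, circ_mulCochain_left, circ_mulCochain_right,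
    sub_eq_add_neg, Finset.smul_sum, ← Finset.sum_neg_distrib]
  congr 1
  · rw [add_comm, pow_add, neg_one_sq, mul_one]
    rfl
  · refine Finset.sum_congr rfl fun i _ => ?_
    rw [smul_smul, ← neg_smul]
    congr 1
    ring

theorem hochschildSum_eq_gerstenhaberSum (a : CochainSum k A) :
    hochschildSum k A a = gerstenhaberSum k A
      (DirectSum.lof k ℕ (fun n => Cochain k A n) 1 (mulCochain k A)) a := by
  suffices hochschildSum k A = gerstenhaberSum k A
      (DirectSum.lof k ℕ (fun n => Cochain k A n) 1 (mulCochain k A)) from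
    LinearMap.congr_fun this a
  refine DirectSum.linearMap_ext k fun n => LinearMap.ext fun f => ?_
  rw [LinearMap.comp_apply, LinearMap.comp_apply, hochschildSum, DirectSum.toModule_lof,
    gerstenhaberSum, sumBilin_lof]
  exact cochain_lof_congr k (add_comm n 1) (hochschild_eq_gerstenhaber k f)

theorem coe_eq_cochainCoder_mulCochain {χ : TCoDer k A 1} (hχ : CorrespondsToMul k A χ) :
    (χ : Module.End k (TensorSum k (Desusp A))) = cochainCoder k (mulCochain k A) := by
  refine eq_cochainCoder k (n := 1) χ.2 fun v => Eq.trans ?_ (hχ (v 0) (v 1))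
  refine congrArg (fun w => corestriction k (Desusp A) χ 1 (PiTensorProduct.tprod k w)) ?_
  funext j
  fin_cases j <;> rfl

theorem cochainCoderEquiv_hochschildSum {χ : TCoDer k A 1} (hχ : CorrespondsToMul k A χ)
    (a : CochainSum k A) :
    cochainCoderEquiv k A (hochschildSum k A a)
      = tCoDerDifferential k χ (cochainCoderEquiv k A a) := by
  rw [hochschildSum_eq_gerstenhaberSum, cochainCoderEquiv_bracket, cochainCoderEquiv_lof,
    tCoDerDifferential, coderDifferential]
  congr 2
  exact lof_eq_lof_of_coe_eq Nat.cast_one (coe_eq_cochainCoder_mulCochain k hχ).symm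

theorem isDGLieIso_cochainCoderEquiv {χ : TCoDer k A 1} (hχ : CorrespondsToMul k A χ) :
    IsDGLieIso (L := CochainSum k A) (L' := TCoDerSum k A) (cochainGrading k A)
      (gerstenhaberSum k A) (hochschildSum k A) (tCoDerGrading k A) (tCoDerBracket k A)
      (tCoDerDifferential k χ) (cochainCoderEquiv k A) where
  map_grading := cochainCoderEquiv_mem_iff k
  map_br := cochainCoderEquiv_bracket k
  map_d := cochainCoderEquiv_hochschildSum k hχ

variable (A)

/- The square is a coderivation of degree two whose corestriction is the associator. -/
theorem cochainCoder_mulCochain_sq :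
    cochainCoder k (mulCochain k A) ∘ₗ cochainCoder k (mulCochain k A) = 0 := by
  have hmem := comp_self_mem_CoDer odd_one (cochainCoder_mem k (mulCochain k A))
  have hzero : cochainCoder k (0 : Cochain k A 2) = 0 :=
    congrArg Subtype.val (map_zero (cochainToCoder k 2))
  rw [← hzero]
  refine eq_cochainCoder k hmem fun v => ?_
  rw [LinearMap.comp_apply, tensorProj_cochainCoder_comp k rfl, circ_mulCochain_self]

theorem existsUnique_quadraticDifferential :
    ∃! χ : TCoDer k A 1, IsQuadraticDifferential k A χ ∧ CorrespondsToMul k A χ := by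
  refine ⟨cochainToCoder k 1 (mulCochain k A), ⟨⟨cochainCoder_mulCochain_sq k A, fun n hn => ?_⟩,
    fun a b => ?_⟩, fun χ hχ => Subtype.ext (coe_eq_cochainCoder_mulCochain k hχ.2)⟩
  · exact corestriction_cochainCoder_of_ne k _ (by omega)
  · refine Eq.trans ?_ (corestriction_cochainCoder k (mulCochain k A) ![a, b])
    congr 2

end Differential

/-! ### Naturality -/

section Naturality

variable (k : Type u) [Field k] {A B : Type v} [NonUnitalRing A] [Module k A]
  [NonUnitalRing B] [Module k B]

theorem tensorMapDesusp_downWord (h : A →ₙₐ[k] B) (v : ℕ → A) (N : ℕ) :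
    tensorMapDesusp k h (downWord k v N) = downWord k (fun j => h (v j)) N := by
  rw [tensorMapDesusp, tensorMap, downWord, word, tensorIncl, DirectSum.lmap_lof,
    PiTensorProduct.map_tprod]
  rfl

theorem tensorMapDesusp_comp_cochainCoder (h : A →ₙₐ[k] B) {n : ℕ} {φ : Cochain k A n}
    {ψ : Cochain k B n} (hφψ : ∀ a : Fin (n + 1) → A, h (φ a) = ψ fun i => h (a i)) :
    tensorMapDesusp k h ∘ₗ cochainCoder k φ = cochainCoder k ψ ∘ₗ tensorMapDesusp k h := by
  refine linearMap_ext_downWord k fun v N => ?_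
  rw [LinearMap.comp_apply, LinearMap.comp_apply, tensorMapDesusp_downWord]
  obtain hN | hN := lt_or_ge N n
  · rw [cochainCoder_downWord_of_lt k φ v hN, cochainCoder_downWord_of_lt k ψ _ hN, map_zero]
  · obtain ⟨M, rfl⟩ := Nat.exists_eq_add_of_le' hN
    simp only [cochainCoder_downWord_add, map_sum, map_smul, tensorMapDesusp_downWord,
      map_insertSeq _ _ h hφψ]

end Naturality

end

theorem mainTheorem3_general (k : Type u) [Field k] :
    (∀ (A : Type v) [NonUnitalRing A] [Module k A] [IsScalarTower k A A] [SMulCommClass k A A],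
      ∃! χ : TCoDer k A 1, IsQuadraticDifferential k A χ ∧ CorrespondsToMul k A χ) ∧
    ∃ ξ : ∀ (A : Type v) [NonUnitalRing A] [Module k A] [IsScalarTower k A A]
        [SMulCommClass k A A], CochainSum k A ≃ₗ[k] TCoDerSum k A,
      (∀ (A : Type v) [NonUnitalRing A] [Module k A] [IsScalarTower k A A] [SMulCommClass k A A]
        (χ : TCoDer k A 1), IsQuadraticDifferential k A χ → CorrespondsToMul k A χ →
        IsDGLie (cochainGrading k A) (gerstenhaberSum k A) (hochschildSum k A) ∧
        IsDGLie (L := TCoDerSum k A) (tCoDerGrading k A) (tCoDerBracket k A)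
          (tCoDerDifferential k χ) ∧
        IsDGLieIso (L := CochainSum k A) (L' := TCoDerSum k A) (cochainGrading k A)
          (gerstenhaberSum k A) (hochschildSum k A) (tCoDerGrading k A) (tCoDerBracket k A)
          (tCoDerDifferential k χ) (ξ A)) ∧
      (∀ (A : Type v) [NonUnitalRing A] [Module k A] [IsScalarTower k A A] [SMulCommClass k A A]
        (n : ℕ) (φ : Cochain k A n), ∃ θ : TCoDer k A n, IsCoderivationOf k φ θ ∧
          ξ A (DirectSum.lof k ℕ (fun n => Cochain k A n) n φ)
            = DirectSum.lof k ℤ (fun d => TCoDer k A d) n θ) ∧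
      (∀ (A : Type v) [NonUnitalRing A] [Module k A] [IsScalarTower k A A] [SMulCommClass k A A]
        (B : Type v) [NonUnitalRing B] [Module k B] [IsScalarTower k B B] [SMulCommClass k B B]
        (h : A →ₙₐ[k] B) (n : ℕ) (φ : Cochain k A n) (ψ : Cochain k B n),
        (∀ a : Fin (n + 1) → A, h (φ a) = ψ fun i => h (a i)) →
        tensorMapDesusp k h ∘ₗ
            (ξ A (DirectSum.lof k ℕ (fun n => Cochain k A n) n φ) n :
              Module.End k (TensorSum k (Desusp A)))
          = (ξ B (DirectSum.lof k ℕ (fun n => Cochain k B n) n ψ) n :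
              Module.End k (TensorSum k (Desusp B))) ∘ₗ tensorMapDesusp k h) := by
  refine ⟨existsUnique_quadraticDifferential k, fun A => cochainCoderEquiv k A, ?_, ?_, ?_⟩
  · intro A _ _ _ _ χ hχ hμ
    have hiso := isDGLieIso_cochainCoderEquiv k hμ
    have hlie := isDGLie_coder hχ.1
    exact ⟨hiso.isDGLie hlie (DirectSum.Decomposition.isInternal _), hlie, hiso⟩
  · intro A _ _ _ _ n φ
    exact ⟨cochainToCoder k n φ, isCoderivationOf_cochainToCoder k φ, cochainCoderEquiv_lof k n φ⟩
  · intro A _ _ _ _ B _ _ _ _ h n φ ψ hφψ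
    rw [coe_cochainCoderEquiv_lof, coe_cochainCoderEquiv_lof]
    exact tensorMapDesusp_comp_cochainCoder k h hφψ

theorem mainTheorem3 (k : Type u) [Field k] [CharZero k] :
    -- the quadratic differential `χ` corresponding to the multiplication exists and is unique
    (∀ (A : Type v) [NonUnitalRing A] [Module k A] [IsScalarTower k A A] [SMulCommClass k A A],
      ∃! χ : TCoDer k A 1, IsQuadraticDifferential k A χ ∧ CorrespondsToMul k A χ) ∧
    ∃ ξ : ∀ (A : Type v) [NonUnitalRing A] [Module k A] [IsScalarTower k A A]
        [SMulCommClass k A A], CochainSum k A ≃ₗ[k] TCoDerSum k A,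
      -- `ξ A` is an isomorphism of dg-Lie algebras
      (∀ (A : Type v) [NonUnitalRing A] [Module k A] [IsScalarTower k A A] [SMulCommClass k A A]
        (χ : TCoDer k A 1), IsQuadraticDifferential k A χ → CorrespondsToMul k A χ →
        IsDGLie (cochainGrading k A) (gerstenhaberSum k A) (hochschildSum k A) ∧
        IsDGLie (L := TCoDerSum k A) (tCoDerGrading k A) (tCoDerBracket k A) (tCoDerDifferential k χ) ∧
        IsDGLieIso (L := CochainSum k A) (L' := TCoDerSum k A) (cochainGrading k A) (gerstenhaberSum k A) (hochschildSum k A)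
          (tCoDerGrading k A) (tCoDerBracket k A) (tCoDerDifferential k χ) (ξ A)) ∧
      -- `ξ A` sends a cochain to the coderivation with the corresponding corestriction
      (∀ (A : Type v) [NonUnitalRing A] [Module k A] [IsScalarTower k A A] [SMulCommClass k A A]
        (n : ℕ) (φ : Cochain k A n), ∃ θ : TCoDer k A n, IsCoderivationOf k φ θ ∧
          ξ A (DirectSum.lof k ℕ (fun n => Cochain k A n) n φ)
            = DirectSum.lof k ℤ (fun d => TCoDer k A d) n θ) ∧
      -- `ξ` is natural: it sends cochains related by an algebra homomorphism to coderivations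
      -- related by the induced map of tensor coalgebras
      (∀ (A : Type v) [NonUnitalRing A] [Module k A] [IsScalarTower k A A] [SMulCommClass k A A]
        (B : Type v) [NonUnitalRing B] [Module k B] [IsScalarTower k B B] [SMulCommClass k B B]
        (h : A →ₙₐ[k] B) (n : ℕ) (φ : Cochain k A n) (ψ : Cochain k B n),
        (∀ a : Fin (n + 1) → A, h (φ a) = ψ fun i => h (a i)) →
        tensorMapDesusp k h ∘ₗ
            (ξ A (DirectSum.lof k ℕ (fun n => Cochain k A n) n φ) n :
              Module.End k (TensorSum k (Desusp A)))
          = (ξ B (DirectSum.lof k ℕ (fun n => Cochain k B n) n ψ) n :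
              Module.End k (TensorSum k (Desusp B))) ∘ₗ tensorMapDesusp k h) :=
  mainTheorem3_general k
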